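/- Fix $\gamma>0$ and let $r_1\in(0,1)$ be the solution of $x+x^{1+\gamma}=1$. Let $f\colon[0,1]\to[0,1]$ be the Manneville--Pomeau map, $f(x)=x+x^{1+\gamma}$ for $0\le x<r_1$ and $f(x)=x+x^{1+\gamma}-1$ for $r_1\le x\le 1$. Let $F(x)=f^{\tau(x)}(x)$, with $\tau(x)=\min\{n\ge 1: f^n(x)\in[r_1,1]\}$, be the first return map of $f$ to $[r_1,1]$; it is defined on $(r_1,1]$, and the point $r_1$, which $f$ sends to the fixed point $0$, never returns. Strong game. For $\alpha,\beta\in(0,1)$, Bob and Alice alternately choose nondegenerate closed intervals $[r_1,1]\supseteq B_1\supseteq A_1\supseteq B_2\supseteq A_2\supseteq\cdots$ with $|A_n|\ge\alpha|B_n|$ and $|B_{n+1}|\ge\beta|A_n|$, Bob choosing first. A set $S$ is $(\alpha,\beta)$-strong winning on $[r_1,1]$ if Alice has a strategy that guarantees, whatever Bob does, that $\bigcap_n A_n$ is a single point and that this point lies in $S$. It is $\alpha$-strong winning if this holds for every $\beta\in(0,1)$, and strong winning if it is $\alpha$-strong winning for some $\alpha\in(0,1)$. Basic intervals. Put $r_0=p_0=1$;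 for $n\ge0$ let $r_{n+1}>0$ solve $x+x^{1+\gamma}=r_n$, and for $n\ge1$ let $p_n\in(r_1,1)$ solve $x+x^{1+\gamma}-1=r_n$. For a finite nonempty sequence $\sigma=(m_1,\dots,m_n)$ of positive integers let $J_\sigma$ be the closure of $\{x\in[r_1,1]: F^{i-1}x\in[p_{m_i},p_{m_i-1})\text{ for }1\le i\le n\}$, write $\sigma k$ for $\sigma$ followed by $k$, and let $|\cdot|$ denote diameter. Theorem. The set $$\mathcal E_F=\{x\in[r_1,1]:\ [r_1,r_1+\varepsilon)\cap\{F^nx\}_{n\ge0}=\emptyset\text{ for some }\varepsilon>0\}$$ is strong winning on $[r_1,1]$. Explicitly, there exists a constant $C_5>1$ such that, for all such $\sigma$ and all integers $k\ge1$, $$C_5^{-1}k^{-1/\gamma}\le\frac{\bigl|\bigcup_{i\ge k}J_{\sigma i}\bigr|}{|J_\sigma|}\le C_5k^{-1/\gamma},\qquad C_5^{-1}k^{-1-1/\gamma}\le\frac{|J_{\sigma k}|}{|J_\sigma|}\le C_5k^{-1-1/\gamma},$$ and for every constant $C_5>1$ with this property $\mathcal E_F$ is $\alpha$-strong winning on $[r_1,1]$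 with $\alpha=2^{-2-1/\gamma}C_5^{-1}$. (A point whose orbit reaches $r_1$, where $F$ is not defined, does not belong to $\mathcal E_F$.) -/

import Mathlib

open Set

/-! ### The strong (McMullen) version of Schmidt's game on a set of reals -/

namespace SchmidtGame

/-- A nondegenerate closed bounded interval `[lo, hi]` of the real line. -/
structure Seg where
  lo : ℝ
  hi : ℝ
  lt : lo < hi

/-- The underlying set of points of a closed interval. -/
def Seg.pts (I : Seg) : Set ℝ := Icc I.lo I.hi

/-- The length of a closed interval. -/
def Seg.len (I : Seg) : ℝ := I.hi - I.lo

/-- A strategy for Alice: it answers the finite list `[B 0, …, B n]` of all the moves that Bob has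
made so far with her next interval. (Her own earlier moves are determined by the same data.) -/
abbrev Strategy := List Seg → Seg

/-- Alice's `n`-th move when she follows `s` and Bob's moves are `B 0, B 1, …`. -/
def Strategy.reply (s : Strategy) (B : ℕ → Seg) (n : ℕ) : Seg :=
  s ((List.range (n + 1)).map B)

/-- All of Bob's moves are legal in the strong game with parameter `β` on `X`, against `s`:
`B 0 ⊆ X`, `B (n+1) ⊆ A n` and `|B (n+1)| ≥ β |A n|`. -/
def BobLegal (β : ℝ) (X : Set ℝ) (s : Strategy) (B : ℕ → Seg) : Prop :=
  (B 0).pts ⊆ X ∧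
    ∀ n, (B (n + 1)).pts ⊆ (s.reply B n).pts ∧ β * (s.reply B n).len ≤ (B (n + 1)).len

/-- All of Alice's moves are legal in the strong game with parameter `α`:
`A n ⊆ B n` and `|A n| ≥ α |B n|`. -/
def AliceLegal (α : ℝ) (s : Strategy) (B : ℕ → Seg) : Prop :=
  ∀ n, (s.reply B n).pts ⊆ (B n).pts ∧ α * (B n).len ≤ (s.reply B n).len

/-- `S` is `(α, β)`-strong winning for the game played on `X`: Alice has a strategy such that,
whatever legal moves Bob makes, her moves are legal and the intersection of the intervals played
is a single point, which belongs to `S`. -/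
def IsStrongWinningWith (α β : ℝ) (X S : Set ℝ) : Prop :=
  ∃ s : Strategy, ∀ B : ℕ → Seg, BobLegal β X s B →
    AliceLegal α s B ∧ ∃ w ∈ S, ⋂ n, (s.reply B n).pts = {w}

/-- `S` is `α`-strong winning on `X`. -/
def IsAlphaStrongWinning (α : ℝ) (X S : Set ℝ) : Prop :=
  ∀ β ∈ Ioo (0 : ℝ) 1, IsStrongWinningWith α β X S

/-- `S` is strong winning on `X`. -/
def IsStrongWinning (X S : Set ℝ) : Prop :=
  ∃ α ∈ Ioo (0 : ℝ) 1, IsAlphaStrongWinning α X S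

end SchmidtGame

/-! ### The Manneville–Pomeau map and its first return map -/

namespace MannevillePomeau

/-- The nonnegative solution `x` of `x + x ^ (1 + γ) = y` (see `root_spec`, `root_unique`). -/
noncomputable def root (γ y : ℝ) : ℝ := sInf {x : ℝ | 0 ≤ x ∧ x + x ^ (1 + γ) = y}

theorem root_existsUnique {γ y : ℝ} (hγ : 0 < γ) (hy : 0 ≤ y) :
    ∃! x : ℝ, 0 ≤ x ∧ x + x ^ (1 + γ) = y := by
  have hmono : StrictMonoOn (fun x : ℝ => x + x ^ (1 + γ)) (Ici 0) := by
    intro a ha b _ hab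
    have := Real.rpow_lt_rpow (z := 1 + γ) ha hab (by linarith)
    simp only
    linarith
  have hcont : ContinuousOn (fun x : ℝ => x + x ^ (1 + γ)) (Icc 0 y) :=
    (continuous_id.add (Real.continuous_rpow_const (by linarith))).continuousOn
  have hmem : y ∈ Icc ((0 : ℝ) + 0 ^ (1 + γ)) (y + y ^ (1 + γ)) := by
    rw [Real.zero_rpow (by linarith)]
    exact ⟨by linarith, by linarith [Real.rpow_nonneg hy (1 + γ)]⟩
  obtain ⟨x, hx, hxy⟩ := intermediate_value_Icc hy hcont hmem
  refine ⟨x, ⟨hx.1, hxy⟩, fun z hz => hmono.injOn hz.1 hx.1 ?_⟩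
  simp only at hxy ⊢
  rw [hz.2, hxy]

theorem root_unique {γ y x : ℝ} (hγ : 0 < γ) (hx : 0 ≤ x) (h : x + x ^ (1 + γ) = y) :
    root γ y = x := by
  have hy : 0 ≤ y := by rw [← h]; linarith [Real.rpow_nonneg hx (1 + γ)]
  have : {x : ℝ | 0 ≤ x ∧ x + x ^ (1 + γ) = y} = {x} := by
    ext z
    exact ⟨fun hz => (root_existsUnique hγ hy).unique hz ⟨hx, h⟩, fun hz => hz ▸ ⟨hx, h⟩⟩
  rw [root, this, csInf_singleton]

theorem root_spec {γ y : ℝ} (hγ : 0 < γ) (hy : 0 ≤ y) :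
    0 ≤ root γ y ∧ root γ y + root γ y ^ (1 + γ) = y := by
  obtain ⟨x, hx, -⟩ := root_existsUnique hγ hy
  rw [root_unique hγ hx.1 hx.2]
  exact hx

/-- The decreasing sequence `r 0 = 1`, with `r (n+1)` the preimage of `r n` under the left branch
`x ↦ x + x ^ (1 + γ)`. In particular `r γ 1` is the solution of `x + x ^ (1 + γ) = 1`. -/
noncomputable def r (γ : ℝ) : ℕ → ℝ
  | 0 => 1
  | n + 1 => root γ (r γ n)

/-- The decreasing sequence `p 0 = 1`, with `p n` for `n ≥ 1` the preimage of `r n` under the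
right branch `x ↦ x + x ^ (1 + γ) - 1`. -/
noncomputable def p (γ : ℝ) : ℕ → ℝ
  | 0 => 1
  | n + 1 => root γ (1 + r γ (n + 1))

/-- The Manneville–Pomeau map (only its values on `[0, 1]` matter). -/
noncomputable def f (γ x : ℝ) : ℝ :=
  if x < r γ 1 then x + x ^ (1 + γ) else x + x ^ (1 + γ) - 1

/-- The first return time to `[r₁, 1]`. It is a genuine minimum at every point of `(r₁, 1]`.
The point `r₁` never returns (it is sent to the fixed point `0`). -/
noncomputable def returnTime (γ x : ℝ) : ℕ :=
  sInf {n : ℕ | 1 ≤ n ∧ (f γ)^[n] x ∈ Icc (r γ 1) 1}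

/-- The first return map to `[r₁, 1]`. At `r₁`, which never returns, it has the conventional value
`r₁`; this value affects none of the definitions below. -/
noncomputable def F (γ x : ℝ) : ℝ := (f γ)^[returnTime γ x] x

/-- The points of `[r₁, 1]` whose forward `F`-orbit misses `[r₁, r₁ + ε)` for some `ε > 0`.
(An orbit that reaches `r₁`, where `F` is conventional, does not qualify in any case.) -/
def EF (γ : ℝ) : Set ℝ :=
  {x | x ∈ Icc (r γ 1) 1 ∧ ∃ ε > 0, ∀ n : ℕ, (F γ)^[n] x ∉ Ico (r γ 1) (r γ 1 + ε)}

/-- The basic interval `J_σ` with itinerary `σ = [m₁, …, m_k]`, all `m_i ≥ 1`: the closure of the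
set of points of `[r₁, 1]` with `F^(i-1) x ∈ [p_{m_i}, p_{m_i - 1})` for `i = 1, …, k`. -/
def basicInterval (γ : ℝ) (σ : List ℕ) : Set ℝ :=
  closure {x | x ∈ Icc (r γ 1) 1 ∧
    ∀ i : Fin σ.length, (F γ)^[(i : ℕ)] x ∈ Ico (p γ (σ.get i)) (p γ (σ.get i - 1))}

/-- The length estimates for basic intervals, with constant `C`: for every basic interval `J_σ` of
generation at least one and every `k ≥ 1`,
`C⁻¹ k^(-1/γ) ≤ |⋃_{i ≥ k} J_{σ i}| / |J_σ| ≤ C k^(-1/γ)` and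
`C⁻¹ k^(-1-1/γ) ≤ |J_{σ k}| / |J_σ| ≤ C k^(-1-1/γ)`. Here `|·|` is the diameter. -/
def LengthEstimates (γ C : ℝ) : Prop :=
  ∀ σ : List ℕ, σ ≠ [] → (∀ m ∈ σ, 1 ≤ m) → ∀ k : ℕ, 1 ≤ k →
    (C⁻¹ * (k : ℝ) ^ (-(1 / γ)) ≤
        Metric.diam (⋃ i ∈ Ici k, basicInterval γ (σ ++ [i])) / Metric.diam (basicInterval γ σ) ∧
      Metric.diam (⋃ i ∈ Ici k, basicInterval γ (σ ++ [i])) / Metric.diam (basicInterval γ σ) ≤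
        C * (k : ℝ) ^ (-(1 / γ))) ∧
    (C⁻¹ * (k : ℝ) ^ (-1 - 1 / γ) ≤
        Metric.diam (basicInterval γ (σ ++ [k])) / Metric.diam (basicInterval γ σ) ∧
      Metric.diam (basicInterval γ (σ ++ [k])) / Metric.diam (basicInterval γ σ) ≤
        C * (k : ℝ) ^ (-1 - 1 / γ))

end MannevillePomeau

/-! Write `a σ` for the left endpoint of the interval with word `σ`, the image of `r₁` under the
inverse branch `wordBranch γ σ`, and `ℓ σ` for its length. An orbit comes close to `r₁` exactly when
its starting point lies just to the right of some `a σ`, at a distance small relative to `ℓ σ`. So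
it suffices that Alice stays a fixed proportion `η` of `ℓ σ` away from every `a σ`, on its right
side.

Two facts make this possible. Bounded distortion of the inverse branches
(`exists_wordBranch_sub_mul_le`) turns "relatively close to `a σ`" into "the corresponding iterate
is close to `r₁`". Separation (`exists_min_length_le`) says that two distinct left endpoints are at
least a constant times the smaller of the two lengths apart. Hence Bob's interval contains at most
one endpoint whose interval is long compared with it, and a quarter of Bob's interval always avoids
that endpoint with room to spare (`avoid_spec`). This gives the winning parameter `1/4` for every
`β` (`isAlphaStrongWinning_quarter`). The explicit `α` of the theorem is smaller than `1/4`, and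
winning passes to smaller `α`.

The distortion bound rests on telescoping: the logarithm of `stepDeriv` varies by at most a multiple
of the variation of `x ^ γ`, and along the backward orbit these variations sum to at most `1`,
although the fixed point `0` is neutral. The length estimates follow from the same distortion bound
and the decay of `r γ n` like `n ^ (-1/γ)`. -/

namespace SchmidtGame

/-! ### Alice's strategy in an abstract separated family -/

theorem IsAlphaStrongWinning.mono {α α' : ℝ} {X S : Set ℝ} (h : IsAlphaStrongWinning α X S)
    (hα : α' ≤ α) : IsAlphaStrongWinning α' X S := by
  intro β hβ
  obtain ⟨s, hs⟩ := h β hβ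
  refine ⟨s, fun B hB => ⟨fun n => ⟨((hs B hB).1 n).1, le_trans ?_ ((hs B hB).1 n).2⟩, (hs B hB).2⟩⟩
  exact mul_le_mul_of_nonneg_right hα (sub_nonneg.2 (B n).lt.le)

/-- The right quarter of an interval. -/
noncomputable def Seg.rightQuarter (I : Seg) : Seg :=
  ⟨I.hi - (I.hi - I.lo) / 4, I.hi, by linarith [I.lt]⟩

/-- The second and third eighths of an interval. -/
noncomputable def Seg.secondQuarter (I : Seg) : Seg :=
  ⟨I.lo + (I.hi - I.lo) / 8, I.lo + 3 * (I.hi - I.lo) / 8, by linarith [I.lt]⟩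

open Classical in
/-- Alice's answer to `I` when she wants to stay away from those points `a i` that are the left
endpoints of intervals of length `ℓ i > M |I|`. -/
noncomputable def avoid {ι : Type*} (a ℓ : ι → ℝ) (M : ℝ) (I : Seg) : Seg :=
  if ∃ i, M * I.len < ℓ i ∧ a i ∈ Icc I.lo (I.lo + 3 * I.len / 8) then I.rightQuarter
  else I.secondQuarter

/-- By `hsep`, two distinct endpoints with `ℓ > M |I|` are more than `|I|` apart, so `I` contains at
most one. If it is in the first three eighths, the right quarter keeps clear of it. Otherwise the
second and third eighths do. The margin `|I| / 8` on the left is what survives to the limit point.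
-/
theorem avoid_spec {ι : Type*} {a ℓ : ι → ℝ} {M : ℝ} (hM : 0 < M)
    (hsep : ∀ i j, a i < a j → min (ℓ i) (ℓ j) ≤ M * (a j - a i)) (I : Seg) :
    (avoid a ℓ M I).len = I.len / 4 ∧ I.lo + I.len / 8 ≤ (avoid a ℓ M I).lo ∧
      (avoid a ℓ M I).hi ≤ I.hi ∧
      ∀ i, M * I.len < ℓ i →
        a i ∉ Icc ((avoid a ℓ M I).lo - I.len / 8) (avoid a ℓ M I).hi := by
  have hlt := I.lt
  by_cases h : ∃ i, M * I.len < ℓ i ∧ a i ∈ Icc I.lo (I.lo + 3 * I.len / 8)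
  · have hA : avoid a ℓ M I = I.rightQuarter := if_pos h
    rw [hA]
    simp only [Seg.rightQuarter, Seg.len] at *
    refine ⟨by ring, by linarith, le_rfl, fun j hj hmem => ?_⟩
    obtain ⟨i, hi, hil, hih⟩ := h
    have h1 := hsep i j (by linarith [hmem.1])
    have h2 := lt_of_lt_of_le (lt_min hi hj) h1
    have h3 := lt_of_mul_lt_mul_left h2 hM.le
    linarith [hmem.2]
  · have hA : avoid a ℓ M I = I.secondQuarter := if_neg h
    rw [hA]
    push Not at h
    simp only [Seg.secondQuarter, Seg.len] at *
    refine ⟨by ring, by linarith, by linarith, fun j hj hmem => h j hj ⟨?_, hmem.2⟩⟩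
    linarith [hmem.1]

/-- If `S` contains every point of `X` that keeps a fixed relative distance to the right of the left
endpoint of each of a family of bounded intervals `[a i, a i + ℓ i]`, and two of these intervals can
have close left endpoints only if one of them is short, then `S` is strong winning. -/
theorem isAlphaStrongWinning_quarter {ι : Type*} {a ℓ : ι → ℝ} {M L : ℝ} {X S : Set ℝ}
    (hM : 0 < M) (hL : ∀ i, ℓ i ≤ L)
    (hsep : ∀ i j, a i < a j → min (ℓ i) (ℓ j) ≤ M * (a j - a i))
    (hS : ∀ η > 0, ∀ w ∈ X, (∀ i, 0 < ℓ i → w ∉ Icc (a i) (a i + η * ℓ i)) → w ∈ S) :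
    IsAlphaStrongWinning (1 / 4) X S := by
  rintro β ⟨hβ, -⟩
  -- Only Bob's last interval matters. The default `[0, 1]` is never used, since the list of his
  -- moves is nonempty.
  refine ⟨fun l => avoid a ℓ M (l.getLastD ⟨0, 1, one_pos⟩), fun B ⟨hB0, hB⟩ => ?_⟩
  have hrep : ∀ n, Strategy.reply (fun l => avoid a ℓ M (l.getLastD ⟨0, 1, one_pos⟩)) B n =
      avoid a ℓ M (B n) := by
    intro n
    simp [Strategy.reply, List.range_succ]
  simp only [hrep, AliceLegal] at hB ⊢
  set A : ℕ → Seg := fun n => avoid a ℓ M (B n) with hA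
  have hlen : ∀ n, (A n).len = (B n).len / 4 := fun n => (avoid_spec hM hsep (B n)).1
  have hBpos : ∀ n, 0 < (B n).len := fun n => sub_pos.2 (B n).lt
  have hAB : ∀ n, (A n).pts ⊆ (B n).pts := fun n =>
    Icc_subset_Icc (by linarith [(avoid_spec hM hsep (B n)).2.1, hBpos n])
      (avoid_spec hM hsep (B n)).2.2.1
  have hanti : Antitone fun n => Icc (A n).lo (A n).hi :=
    antitone_nat_of_succ_le fun n => (hAB (n + 1)).trans (hB n).1
  have hw := ciSup_mem_iInter_Icc_of_antitone_Icc hanti fun n => (A n).lt.le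
  set w := ⨆ n, (A n).lo
  have hwA : ∀ n, w ∈ (A n).pts := fun n => mem_iInter.1 hw n
  have hdecay : ∀ n, (B n).len ≤ (B 0).len * (1 / 4) ^ n := by
    intro n
    induction n with
    | zero => simp
    | succ n ih =>
      have h1 := (Icc_subset_Icc_iff (B (n + 1)).lt.le).1 (hB n).1
      have h2 : (B (n + 1)).len ≤ (A n).len := sub_le_sub h1.2 h1.1
      rw [hlen] at h2
      rw [pow_succ]
      linarith
  have hlim : Filter.Tendsto (fun n => (B 0).len * (1 / 4 : ℝ) ^ n) Filter.atTop (nhds 0) := by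
    simpa using (tendsto_pow_atTop_nhds_zero_of_lt_one (r := (1 / 4 : ℝ)) (by norm_num)
      (by norm_num)).const_mul (B 0).len
  refine ⟨fun n => ⟨hAB n, by linarith [hlen n]⟩, w, ?_, ?_⟩
  -- The bound with `L` starts the induction in `key` at Bob's first move. The bound with `β`
  -- carries it on, as `|B (n+1)| ≥ β |A n| = β |B n| / 4`.
  · obtain ⟨η, hη, hη1, hη2⟩ : ∃ η > 0, η * L ≤ (B 0).len / 8 ∧ η * M * 4 ≤ β / 8 := by
      have hLpos : 0 < |L| + 1 := by positivity
      refine ⟨min ((B 0).len / 8 / (|L| + 1)) (β / 8 / (M * 4)),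
        lt_min (by have := hBpos 0; positivity) (by positivity), ?_, ?_⟩
      · calc _ ≤ min ((B 0).len / 8 / (|L| + 1)) (β / 8 / (M * 4)) * (|L| + 1) := by
              refine mul_le_mul_of_nonneg_left (by linarith [le_abs_self L]) ?_
              exact le_min (by have := hBpos 0; positivity) (by positivity)
          _ ≤ (B 0).len / 8 / (|L| + 1) * (|L| + 1) :=
              mul_le_mul_of_nonneg_right (min_le_left _ _) hLpos.le
          _ = _ := div_mul_cancel₀ _ hLpos.ne'
      · rw [mul_assoc]
        calc _ ≤ β / 8 / (M * 4) * (M * 4) :=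
              mul_le_mul_of_nonneg_right (min_le_right _ _) (by positivity)
          _ = _ := div_mul_cancel₀ _ (by positivity)
    -- A limit point too close to `a i` forces `ℓ i` to stay below `M |B n|` for every `n`. As these
    -- lengths tend to `0`, this contradicts `0 < ℓ i`.
    have key : ∀ i, w ∈ Icc (a i) (a i + η * ℓ i) → ∀ n, ℓ i ≤ M * (B n).len := by
      intro i hi n
      have main : ∀ n, η * ℓ i ≤ (B n).len / 8 → ℓ i ≤ M * (B n).len := by
        intro n hn
        by_contra! hcon
        have h1 := (avoid_spec hM hsep (B n)).2.2.2 i hcon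
        have h2 := hwA n
        exact h1 ⟨by linarith [h2.1, hi.2], hi.1.trans h2.2⟩
      induction n with
      | zero => exact main 0 ((mul_le_mul_of_nonneg_left (hL i) hη.le).trans hη1)
      | succ n ih =>
        refine main _ ?_
        have h1 := (hB n).2
        have h2 := hlen n
        calc η * ℓ i ≤ η * (M * (B n).len) := mul_le_mul_of_nonneg_left ih hη.le
          _ = η * M * 4 * (A n).len := by rw [h2]; ring
          _ ≤ β / 8 * (A n).len :=
              mul_le_mul_of_nonneg_right hη2 (sub_nonneg.2 (A n).lt.le)
          _ ≤ _ := by linarith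
    refine hS η hη w (hB0 (hAB 0 (hwA 0))) fun i hi0 hi => ?_
    have h1 : Filter.Tendsto (fun n => M * ((B 0).len * (1 / 4 : ℝ) ^ n)) Filter.atTop
        (nhds 0) := by simpa using hlim.const_mul M
    exact hi0.not_ge (ge_of_tendsto' h1 fun n =>
      (key i hi n).trans (mul_le_mul_of_nonneg_left (hdecay n) hM.le))
  · refine subset_antisymm (fun z hz => ?_) (by simpa using hwA)
    have hz' : ∀ n, z ∈ (A n).pts := fun n => mem_iInter.1 hz n
    have h1 : |z - w| ≤ 0 := ge_of_tendsto' hlim fun n => by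
      refine le_trans ?_ (hdecay n)
      have h2 := hz' n
      have h3 := hwA n
      have h4 := hlen n
      have h5 := hBpos n
      simp only [Seg.pts, Seg.len, mem_Icc] at h2 h3 h4 h5 ⊢
      rw [abs_le]
      constructor <;> linarith
    simpa [sub_eq_zero] using h1

end SchmidtGame

/-! ### The unbranched map and its inverse -/

namespace MannevillePomeau

/-- The unbranched map `x ↦ x + x ^ (1 + γ)`, of which `root` is the inverse on `[0, ∞)`. -/
noncomputable def step (γ x : ℝ) : ℝ := x + x ^ (1 + γ)

/-- The derivative of `step`. -/
noncomputable def stepDeriv (γ x : ℝ) : ℝ := 1 + (1 + γ) * x ^ γ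

section
variable {γ : ℝ} (hγ : 0 < γ)
include hγ

theorem sub_le_step_sub {x y : ℝ} (hx : 0 ≤ x) (hxy : x ≤ y) : y - x ≤ step γ y - step γ x := by
  have := Real.rpow_le_rpow hx hxy (by linarith : 0 ≤ 1 + γ)
  simp only [step]
  linarith

theorem root_nonneg {y : ℝ} (hy : 0 ≤ y) : 0 ≤ root γ y := (root_spec hγ hy).1

theorem step_root {y : ℝ} (hy : 0 ≤ y) : step γ (root γ y) = y := (root_spec hγ hy).2

theorem root_lt_root {x y : ℝ} (hx : 0 ≤ x) (hxy : x < y) : root γ x < root γ y := by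
  by_contra! h
  have := sub_le_step_sub hγ (root_nonneg hγ (hx.trans hxy.le)) h
  rw [step_root hγ hx, step_root hγ (hx.trans hxy.le)] at this
  linarith

theorem root_le_root {x y : ℝ} (hx : 0 ≤ x) (hxy : x ≤ y) : root γ x ≤ root γ y := by
  rcases hxy.eq_or_lt with rfl | h
  · exact le_rfl
  · exact (root_lt_root hγ hx h).le

theorem root_sub_le {x y : ℝ} (hx : 0 ≤ x) (hxy : x ≤ y) : root γ y - root γ x ≤ y - x := by
  have := sub_le_step_sub hγ (root_nonneg hγ hx) (root_le_root hγ hx hxy)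
  rwa [step_root hγ hx, step_root hγ (hx.trans hxy)] at this

theorem root_zero : root γ 0 = 0 :=
  root_unique hγ le_rfl (by rw [Real.zero_rpow (by linarith), add_zero])

theorem root_two : root γ 2 = 1 :=
  root_unique hγ zero_le_one (by rw [Real.one_rpow]; norm_num)

theorem root_pos {y : ℝ} (hy : 0 < y) : 0 < root γ y := by
  have := root_lt_root hγ le_rfl hy
  rwa [root_zero hγ] at this

theorem continuousAt_root {y : ℝ} (hy : 0 < y) : ContinuousAt (root γ) y := by
  have h : LipschitzOnWith 1 (root γ) (Ici 0) := by
    refine LipschitzOnWith.of_le_add fun x hx y hy => ?_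
    rcases le_total x y with h | h
    · linarith [root_le_root hγ hx h, dist_nonneg (x := x) (y := y)]
    · have := root_sub_le hγ hy h
      rw [Real.dist_eq, abs_of_nonneg (by linarith)]
      linarith
  exact h.continuousOn.continuousAt (Ici_mem_nhds hy)

theorem one_le_stepDeriv {x : ℝ} (hx : 0 ≤ x) : 1 ≤ stepDeriv γ x := by
  have := Real.rpow_nonneg hx γ
  rw [stepDeriv]
  nlinarith

theorem stepDeriv_pos {x : ℝ} (hx : 0 ≤ x) : 0 < stepDeriv γ x :=
  one_pos.trans_le (one_le_stepDeriv hγ hx)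

theorem stepDeriv_le {x : ℝ} (hx : 0 ≤ x) (hx1 : x ≤ 1) : stepDeriv γ x ≤ 2 + γ := by
  have := Real.rpow_le_one hx hx1 hγ.le
  rw [stepDeriv]
  nlinarith

theorem stepDeriv_mono {x y : ℝ} (hx : 0 ≤ x) (hxy : x ≤ y) :
    stepDeriv γ x ≤ stepDeriv γ y := by
  have := Real.rpow_le_rpow hx hxy hγ.le
  simp only [stepDeriv]
  nlinarith

/-- The difference of the derivatives is `(1 + γ) (y ^ γ - x ^ γ)`. It is also a bound for the
relative difference because `stepDeriv ≥ 1`, and `1 + u ≤ exp u`. -/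
theorem stepDeriv_le_exp_mul {x y : ℝ} (hx : 0 ≤ x) (hxy : x ≤ y) :
    stepDeriv γ y ≤ Real.exp ((1 + γ) * (y ^ γ - x ^ γ)) * stepDeriv γ x := by
  have h1 := Real.add_one_le_exp ((1 + γ) * (y ^ γ - x ^ γ))
  have h2 := Real.rpow_le_rpow hx hxy hγ.le
  have h3 := one_le_stepDeriv hγ hx
  have h4 : 0 ≤ (1 + γ) * (y ^ γ - x ^ γ) := mul_nonneg (by linarith) (by linarith)
  calc stepDeriv γ y = stepDeriv γ x + (1 + γ) * (y ^ γ - x ^ γ) := by simp only [stepDeriv]; ring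
    _ ≤ ((1 + γ) * (y ^ γ - x ^ γ) + 1) * stepDeriv γ x := by nlinarith
    _ ≤ _ := mul_le_mul_of_nonneg_right h1 (by linarith)

theorem hasDerivAt_step (x : ℝ) : HasDerivAt (step γ) (stepDeriv γ x) x := by
  have := (hasDerivAt_id x).add (Real.hasDerivAt_rpow_const (x := x) (p := 1 + γ)
    (Or.inr (by linarith)))
  rwa [add_sub_cancel_left] at this

theorem hasDerivAt_root {y : ℝ} (hy : 0 < y) :
    HasDerivAt (root γ) (stepDeriv γ (root γ y))⁻¹ y := by
  refine HasDerivAt.of_local_left_inverse (continuousAt_root hγ hy) (hasDerivAt_step hγ _)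
    (stepDeriv_pos hγ (root_nonneg hγ hy.le)).ne' ?_
  filter_upwards [Ioi_mem_nhds hy] with z hz using step_root hγ (le_of_lt hz)

/-! ### The sequences `r` and `p` -/

omit hγ in
theorem r_eq_iterate (n : ℕ) : r γ n = (root γ)^[n] 1 := by
  induction n with
  | zero => rfl
  | succ n ih => rw [Function.iterate_succ_apply', ← ih, r]

theorem r_pos (n : ℕ) : 0 < r γ n := by
  induction n with
  | zero => exact one_pos
  | succ n ih => exact root_pos hγ ih

theorem r_add_rpow (n : ℕ) : r γ (n + 1) + r γ (n + 1) ^ (1 + γ) = r γ n :=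
  step_root hγ (r_pos hγ n).le

theorem r_succ_lt (n : ℕ) : r γ (n + 1) < r γ n := by
  linarith [r_add_rpow hγ n, Real.rpow_pos_of_pos (r_pos hγ (n + 1)) (1 + γ)]

theorem r_antitone : Antitone (r γ) := antitone_nat_of_succ_le fun n => (r_succ_lt hγ n).le

theorem r_le_one (n : ℕ) : r γ n ≤ 1 := r_antitone hγ (Nat.zero_le n)

theorem r_one_lt : r γ 1 < 1 := r_succ_lt hγ 0

theorem r_le_two_mul (n : ℕ) : r γ n ≤ 2 * r γ (n + 1) := by
  have h := r_add_rpow hγ n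
  have h0 := r_pos hγ (n + 1)
  have h1 := Real.rpow_le_one h0.le (r_le_one hγ (n + 1)) hγ.le
  rw [Real.rpow_add h0, Real.rpow_one] at h
  nlinarith

theorem p_eq (n : ℕ) : p γ n = root γ (1 + r γ n) := by
  cases n with
  | zero => rw [p, r, one_add_one_eq_two, root_two hγ]
  | succ n => rfl

omit hγ in
theorem root_one : root γ 1 = r γ 1 := rfl

theorem r_one_lt_p (n : ℕ) : r γ 1 < p γ n := by
  rw [p_eq hγ, ← root_one]
  exact root_lt_root hγ zero_le_one (by linarith [r_pos hγ n])

theorem p_succ_lt (n : ℕ) : p γ (n + 1) < p γ n := by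
  rw [p_eq hγ, p_eq hγ]
  exact root_lt_root hγ (by linarith [r_pos hγ (n + 1)]) (by linarith [r_succ_lt hγ n])

theorem p_antitone : Antitone (p γ) := antitone_nat_of_succ_le fun n => (p_succ_lt hγ n).le

theorem p_mem_Icc (n : ℕ) : p γ n ∈ Icc (r γ 1) 1 :=
  ⟨(r_one_lt_p hγ n).le, p_antitone hγ (Nat.zero_le n)⟩

/-- `root` contracts by at most `2 + γ` on `[0, 2]`. -/
theorem sub_le_mul_root_sub {x y : ℝ} (hx : 0 < x) (hxy : x ≤ y) (hy : y ≤ 2) :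
    y - x ≤ (2 + γ) * (root γ y - root γ x) := by
  rcases hxy.eq_or_lt with rfl | h
  · simp
  obtain ⟨c, hc, hc'⟩ := exists_hasDerivAt_eq_slope (root γ)
    (fun z => (stepDeriv γ (root γ z))⁻¹) h
    (fun z hz => (hasDerivAt_root hγ (hx.trans_le hz.1)).continuousAt.continuousWithinAt)
    (fun z hz => hasDerivAt_root hγ (hx.trans hz.1))
  have hc0 := root_nonneg hγ (hx.trans hc.1).le
  have hc1 : root γ c ≤ 1 := by
    rw [← root_two hγ]
    exact root_le_root hγ (hx.trans hc.1).le (hc.2.le.trans hy)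
  rw [eq_div_iff (by linarith)] at hc'
  rw [← hc', ← mul_assoc]
  have := stepDeriv_le hγ hc0 hc1
  have hp := stepDeriv_pos hγ hc0
  have : 1 ≤ (2 + γ) * (stepDeriv γ (root γ c))⁻¹ := by
    rw [← div_eq_mul_inv, le_div_iff₀ hp]
    linarith
  nlinarith

theorem p_sub_le (n : ℕ) : p γ n - r γ 1 ≤ r γ n := by
  have := root_sub_le hγ zero_le_one (show 1 ≤ 1 + r γ n by linarith [r_pos hγ n])
  rw [← p_eq hγ, root_one] at this
  linarith

theorem le_p_sub (n : ℕ) : r γ n ≤ (2 + γ) * (p γ n - r γ 1) := by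
  have := sub_le_mul_root_sub hγ one_pos (show 1 ≤ 1 + r γ n by linarith [r_pos hγ n])
    (by linarith [r_le_one hγ n])
  rw [← p_eq hγ, root_one] at this
  linarith

theorem p_sub_p_le (n : ℕ) : p γ n - p γ (n + 1) ≤ r γ (n + 1) ^ (1 + γ) := by
  have := root_sub_le hγ (show 0 ≤ 1 + r γ (n + 1) by linarith [r_pos hγ (n + 1)])
    (show 1 + r γ (n + 1) ≤ 1 + r γ n by linarith [r_succ_lt hγ n])
  rw [← p_eq hγ, ← p_eq hγ] at this
  linarith [r_add_rpow hγ n]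

theorem le_p_sub_p (n : ℕ) : r γ (n + 1) ^ (1 + γ) ≤ (2 + γ) * (p γ n - p γ (n + 1)) := by
  have := sub_le_mul_root_sub hγ (show 0 < 1 + r γ (n + 1) by linarith [r_pos hγ (n + 1)])
    (show 1 + r γ (n + 1) ≤ 1 + r γ n by linarith [r_succ_lt hγ n]) (by linarith [r_le_one hγ n])
  rw [← p_eq hγ, ← p_eq hγ] at this
  linarith [r_add_rpow hγ n]

/-! ### Asymptotics of `r` -/

/-- In the coordinate `x ^ (-γ)` the dynamics near `0` is almost a translation. With `t = r (n+1) ^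
γ` one has `r n ^ (-γ) = t⁻¹ (1 + t) ^ (-γ)`, and `(1 + t) ^ (-γ)` is `1` minus a quantity
comparable to `t`. -/
theorem inv_rpow_r_succ (n : ℕ) :
    (r γ n ^ γ)⁻¹ + γ / (2 + γ) ≤ (r γ (n + 1) ^ γ)⁻¹ ∧
      (r γ (n + 1) ^ γ)⁻¹ ≤ (r γ n ^ γ)⁻¹ + γ := by
  have h0 := r_pos hγ (n + 1)
  set t := r γ (n + 1) ^ γ with ht
  have ht0 : 0 < t := Real.rpow_pos_of_pos h0 γ
  have ht1 : t ≤ 1 := Real.rpow_le_one h0.le (r_le_one hγ _) hγ.le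
  have hr : r γ n = r γ (n + 1) * (1 + t) := by
    rw [← r_add_rpow hγ n, Real.rpow_add h0, Real.rpow_one]
    ring
  have hrn : (r γ n ^ γ)⁻¹ = t⁻¹ * Real.exp (-(γ * Real.log (1 + t))) := by
    rw [hr, Real.mul_rpow h0.le (by linarith), mul_inv, Real.exp_neg,
      Real.rpow_def_of_pos (by linarith : 0 < 1 + t), mul_comm γ]
  have hlog1 : Real.log (1 + t) ≤ t := by
    linarith [Real.log_le_sub_one_of_pos (by linarith : 0 < 1 + t)]
  have hlog2 : t / 2 ≤ Real.log (1 + t) := by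
    have h1 := Real.one_sub_inv_le_log_of_pos (by linarith : 0 < 1 + t)
    have h2 : t / 2 ≤ 1 - (1 + t)⁻¹ := by
      rw [← sub_nonneg]
      have : 1 - (1 + t)⁻¹ - t / 2 = t * (1 - t) / (2 * (1 + t)) := by field_simp; ring
      rw [this]
      exact div_nonneg (mul_nonneg ht0.le (by linarith)) (by linarith)
    linarith
  set E := Real.exp (-(γ * Real.log (1 + t))) with hE
  have hE1 : 1 - γ * t ≤ E := by
    have := Real.add_one_le_exp (-(γ * Real.log (1 + t)))
    nlinarith
  have hE2 : E ≤ 1 - γ / (2 + γ) * t := by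
    have h1 : E ≤ (1 + γ * (t / 2))⁻¹ := by
      rw [hE, Real.exp_neg]
      refine inv_anti₀ (by positivity) ?_
      have := Real.add_one_le_exp (γ * Real.log (1 + t))
      nlinarith
    refine h1.trans ?_
    rw [inv_le_iff_one_le_mul₀ (by positivity), ← sub_nonneg]
    have : (1 - γ / (2 + γ) * t) * (1 + γ * (t / 2)) - 1 =
        γ ^ 2 * t * (1 - t) / (2 * (2 + γ)) := by field_simp; ring
    rw [this]
    exact div_nonneg (mul_nonneg (by positivity) (by linarith)) (by positivity)
  rw [hrn]
  constructor
  · calc t⁻¹ * E + γ / (2 + γ) ≤ t⁻¹ * (1 - γ / (2 + γ) * t) + γ / (2 + γ) := by gcongr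
      _ = t⁻¹ := by field_simp; ring
  · calc t⁻¹ = t⁻¹ * (1 - γ * t) + γ := by field_simp; ring
      _ ≤ t⁻¹ * E + γ := by gcongr

theorem inv_rpow_r_bounds (n : ℕ) :
    1 + γ / (2 + γ) * n ≤ (r γ n ^ γ)⁻¹ ∧ (r γ n ^ γ)⁻¹ ≤ 1 + γ * n := by
  induction n with
  | zero => simp [r]
  | succ n ih =>
    have := inv_rpow_r_succ hγ n
    push_cast
    constructor <;> linarith [ih.1, ih.2]

theorem exists_r_bounds : ∃ c > 0, ∃ C > 0, ∀ n : ℕ, 1 ≤ n →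
    c * (n : ℝ) ^ (-(1 / γ)) ≤ r γ n ∧ r γ n ≤ C * (n : ℝ) ^ (-(1 / γ)) := by
  refine ⟨(1 + γ) ^ (-(1 / γ)), by positivity, (γ / (2 + γ)) ^ (-(1 / γ)), by positivity,
    fun n hn => ?_⟩
  have hn' : (1 : ℝ) ≤ n := by exact_mod_cast hn
  obtain ⟨h1, h2⟩ := inv_rpow_r_bounds hγ n
  have h0 := r_pos hγ n
  have hr : r γ n = ((r γ n ^ γ)⁻¹) ^ (-(1 / γ)) := by
    rw [← Real.rpow_neg h0.le, ← Real.rpow_mul h0.le, neg_mul_neg, mul_one_div_cancel hγ.ne',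
      Real.rpow_one]
  have hneg : -(1 / γ) ≤ 0 := by simp [hγ.le]
  have hpos : 0 < (r γ n ^ γ)⁻¹ := inv_pos.2 (Real.rpow_pos_of_pos h0 γ)
  rw [← Real.mul_rpow (by positivity) (by positivity),
    ← Real.mul_rpow (by positivity) (by positivity)]
  constructor
  · rw [hr]
    exact Real.rpow_le_rpow_of_nonpos hpos (by nlinarith) hneg
  · nth_rw 1 [hr]
    exact Real.rpow_le_rpow_of_nonpos (by positivity) (by linarith) hneg

end

/-! ### Inverse branches and their distortion -/

/-- The derivative of `(root γ)^[n]`. -/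
noncomputable def iterDeriv (γ : ℝ) (n : ℕ) (y : ℝ) : ℝ :=
  ∏ j ∈ Finset.range n, (stepDeriv γ ((root γ)^[j + 1] y))⁻¹

/-- The inverse branch of `F` with return time `m`, mapping `[r₁, 1]` onto `[p_m, p_{m-1}]`. -/
noncomputable def branch (γ : ℝ) (m : ℕ) (y : ℝ) : ℝ := root γ (1 + (root γ)^[m - 1] y)

/-- The derivative of `branch`. -/
noncomputable def branchDeriv (γ : ℝ) (m : ℕ) (y : ℝ) : ℝ :=
  (stepDeriv γ (branch γ m y))⁻¹ * iterDeriv γ (m - 1) y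

/-- The inverse branch of an iterate of `F` along a word of return times. -/
noncomputable def wordBranch (γ : ℝ) : List ℕ → ℝ → ℝ
  | [], y => y
  | m :: σ, y => branch γ m (wordBranch γ σ y)

/-- The derivative of `wordBranch`. -/
noncomputable def wordDeriv (γ : ℝ) : List ℕ → ℝ → ℝ
  | [], _ => 1
  | m :: σ, y => branchDeriv γ m (wordBranch γ σ y) * wordDeriv γ σ y

theorem sub_le_of_hasDerivAt_le {g g' : ℝ → ℝ} {x y c : ℝ} (hxy : x ≤ y)
    (hg : ∀ z ∈ Icc x y, HasDerivAt g (g' z) z) (hc : ∀ z ∈ Icc x y, g' z ≤ c) :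
    g y - g x ≤ c * (y - x) := by
  rcases hxy.eq_or_lt with rfl | h
  · simp
  obtain ⟨z, hz, hz'⟩ := exists_hasDerivAt_eq_slope g g' h
    (fun z hz => (hg z hz).continuousAt.continuousWithinAt)
    (fun z hz => hg z (Ioo_subset_Icc_self hz))
  have := hc z (Ioo_subset_Icc_self hz)
  rwa [hz', div_le_iff₀ (by linarith)] at this

/-- A function whose derivative varies by at most the factor `D` distorts ratios of increments by
at most `D`. -/
theorem increment_mul_le {g g' : ℝ → ℝ} {a b D : ℝ} (hg : ∀ z ∈ Icc a b, HasDerivAt g (g' z) z)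
    (hD : ∀ z ∈ Icc a b, ∀ t ∈ Icc a b, g' z ≤ D * g' t) {x y z t : ℝ} (hx : a ≤ x)
    (hxy : x ≤ y) (hy : y ≤ b) (hz : a ≤ z) (hzt : z ≤ t) (ht : t ≤ b) :
    (g y - g x) * (t - z) ≤ D * (g t - g z) * (y - x) := by
  rcases hzt.eq_or_lt with rfl | h
  · simp
  obtain ⟨c, hc, hc'⟩ := exists_hasDerivAt_eq_slope g g' h
    (fun s hs => (hg s ⟨hz.trans hs.1, hs.2.trans ht⟩).continuousAt.continuousWithinAt)
    (fun s hs => hg s ⟨hz.trans hs.1.le, hs.2.le.trans ht⟩)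
  rw [eq_div_iff (by linarith)] at hc'
  have := sub_le_of_hasDerivAt_le hxy (c := D * g' c)
    (fun s hs => hg s ⟨hx.trans hs.1, hs.2.trans hy⟩)
    (fun s hs => hD s ⟨hx.trans hs.1, hs.2.trans hy⟩ c ⟨hz.trans hc.1.le, hc.2.le.trans ht⟩)
  rw [← hc']
  calc (g y - g x) * (t - z) ≤ D * g' c * (y - x) * (t - z) :=
        mul_le_mul_of_nonneg_right this (by linarith)
    _ = _ := by ring

section
variable {γ : ℝ} (hγ : 0 < γ)
include hγ

theorem iterate_root_nonneg {y : ℝ} (hy : 0 ≤ y) (n : ℕ) : 0 ≤ (root γ)^[n] y := by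
  induction n with
  | zero => exact hy
  | succ n ih => rw [Function.iterate_succ_apply']; exact root_nonneg hγ ih

theorem iterate_root_pos {y : ℝ} (hy : 0 < y) (n : ℕ) : 0 < (root γ)^[n] y := by
  induction n with
  | zero => exact hy
  | succ n ih => rw [Function.iterate_succ_apply']; exact root_pos hγ ih

theorem iterate_root_lt {x y : ℝ} (hx : 0 ≤ x) (hxy : x < y) (n : ℕ) :
    (root γ)^[n] x < (root γ)^[n] y := by
  induction n with
  | zero => exact hxy
  | succ n ih =>
    rw [Function.iterate_succ_apply', Function.iterate_succ_apply']
    exact root_lt_root hγ (iterate_root_nonneg hγ hx n) ih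

theorem iterate_root_le {x y : ℝ} (hx : 0 ≤ x) (hxy : x ≤ y) (n : ℕ) :
    (root γ)^[n] x ≤ (root γ)^[n] y := by
  rcases hxy.eq_or_lt with rfl | h
  · exact le_rfl
  · exact (iterate_root_lt hγ hx h n).le

omit hγ in
theorem iterate_root_r_one (n : ℕ) : (root γ)^[n] (r γ 1) = r γ (n + 1) := by
  rw [r_eq_iterate, r_eq_iterate, ← Function.iterate_add_apply]

theorem iterate_root_mem {y : ℝ} (hy : y ∈ Icc (r γ 1) 1) (n : ℕ) :
    (root γ)^[n] y ∈ Icc (r γ (n + 1)) (r γ n) := by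
  have h0 := (r_pos hγ 1).le
  constructor
  · rw [← iterate_root_r_one]
    exact iterate_root_le hγ h0 hy.1 n
  · rw [r_eq_iterate]
    exact iterate_root_le hγ (h0.trans hy.1) hy.2 n

theorem hasDerivAt_iterate_root {y : ℝ} (hy : 0 < y) (n : ℕ) :
    HasDerivAt (root γ)^[n] (iterDeriv γ n y) y := by
  induction n with
  | zero => simpa [iterDeriv] using hasDerivAt_id y
  | succ n ih =>
    have h := (hasDerivAt_root hγ (iterate_root_pos hγ hy n)).comp y ih
    rw [← Function.iterate_succ', ← Function.iterate_succ_apply' (root γ)] at h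
    rwa [iterDeriv, Finset.prod_range_succ, mul_comm]

theorem iterDeriv_pos {y : ℝ} (hy : 0 < y) (n : ℕ) : 0 < iterDeriv γ n y :=
  Finset.prod_pos fun _ _ => inv_pos.2 (stepDeriv_pos hγ (iterate_root_nonneg hγ hy.le _))

theorem iterDeriv_le_one {y : ℝ} (hy : 0 < y) (n : ℕ) : iterDeriv γ n y ≤ 1 :=
  Finset.prod_le_one
    (fun _ _ => (inv_pos.2 (stepDeriv_pos hγ (iterate_root_nonneg hγ hy.le _))).le)
    fun _ _ => inv_le_one_of_one_le₀ (one_le_stepDeriv hγ (iterate_root_nonneg hγ hy.le _))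

theorem iterDeriv_antitone {x y : ℝ} (hx : 0 < x) (hxy : x ≤ y) (n : ℕ) :
    iterDeriv γ n y ≤ iterDeriv γ n x := by
  refine Finset.prod_le_prod (fun j _ => ?_) fun j _ => ?_
  · exact (inv_pos.2 (stepDeriv_pos hγ (iterate_root_nonneg hγ (hx.le.trans hxy) _))).le
  · exact inv_anti₀ (stepDeriv_pos hγ (iterate_root_nonneg hγ hx.le _))
      (stepDeriv_mono hγ (iterate_root_nonneg hγ hx.le _) (iterate_root_le hγ hx.le hxy _))

theorem inv_stepDeriv_le {x y : ℝ} (hx : 0 ≤ x) (hxy : x ≤ y) :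
    (stepDeriv γ x)⁻¹ ≤ Real.exp ((1 + γ) * (y ^ γ - x ^ γ)) * (stepDeriv γ y)⁻¹ := by
  have h1 := stepDeriv_pos hγ hx
  have h2 := stepDeriv_pos hγ (hx.trans hxy)
  rw [← div_eq_mul_inv, le_div_iff₀ h2, inv_mul_le_iff₀ h1, mul_comm]
  exact stepDeriv_le_exp_mul hγ hx hxy

theorem iterDeriv_le_exp_mul {x y : ℝ} (hx : 0 < x) (hxy : x ≤ y) (n : ℕ) :
    iterDeriv γ n x ≤ Real.exp ((1 + γ) * ∑ j ∈ Finset.range n,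
      (((root γ)^[j + 1] y) ^ γ - ((root γ)^[j + 1] x) ^ γ)) * iterDeriv γ n y := by
  rw [Finset.mul_sum, Real.exp_sum, iterDeriv, iterDeriv, ← Finset.prod_mul_distrib]
  refine Finset.prod_le_prod (fun j _ => ?_) fun j _ => ?_
  · exact (inv_pos.2 (stepDeriv_pos hγ (iterate_root_nonneg hγ hx.le _))).le
  · exact inv_stepDeriv_le hγ (iterate_root_nonneg hγ hx.le _) (iterate_root_le hγ hx.le hxy _)

theorem sum_rpow_sub_r_le_one (n : ℕ) :
    ∑ j ∈ Finset.range n, (r γ (j + 1) ^ γ - r γ (j + 2) ^ γ) ≤ 1 := by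
  rw [Finset.sum_range_sub' (fun j => r γ (j + 1) ^ γ)]
  have h1 := Real.rpow_le_one (r_pos hγ 1).le (r_le_one hγ 1) hγ.le
  have h2 := Real.rpow_nonneg (r_pos hγ (n + 1)).le γ
  simp only [zero_add]
  linarith

/-- The `j`-th preimages of `x` and `y` lie in the same interval `[r (j+1), r j]`, so the
distortions add up to a telescoping sum. This crude bound serves to prove the one proportional to `y
- x` in `rpow_iterate_root_sub_le`. -/
theorem iterDeriv_le_mul {x y : ℝ} (hx : x ∈ Icc (r γ 1) 1) (hy : y ∈ Icc (r γ 1) 1) (n : ℕ) :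
    iterDeriv γ n x ≤ Real.exp (1 + γ) * iterDeriv γ n y := by
  have h0 := r_pos hγ 1
  have hy0 := h0.trans_le hy.1
  rcases le_total x y with hxy | hxy
  · refine (iterDeriv_le_exp_mul hγ (h0.trans_le hx.1) hxy n).trans
      (mul_le_mul_of_nonneg_right (Real.exp_le_exp.2 ?_) (iterDeriv_pos hγ hy0 n).le)
    refine mul_le_of_le_one_right (by linarith)
      ((Finset.sum_le_sum fun j _ => ?_).trans (sum_rpow_sub_r_le_one hγ n))
    have h1 := iterate_root_mem hγ hx (j + 1)
    have h2 := iterate_root_mem hγ hy (j + 1)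
    have h3 := r_pos hγ (j + 2)
    exact sub_le_sub (Real.rpow_le_rpow (h3.le.trans h2.1) h2.2 hγ.le)
      (Real.rpow_le_rpow h3.le h1.1 hγ.le)
  · exact (iterDeriv_antitone hγ hy0 hxy n).trans
      (le_mul_of_one_le_left (iterDeriv_pos hγ hy0 n).le (Real.one_le_exp (by linarith)))

theorem iterate_root_sub_mul_le {x y : ℝ} (hx : r γ 1 ≤ x) (hxy : x ≤ y) (hy : y ≤ 1) (n : ℕ) :
    ((root γ)^[n] y - (root γ)^[n] x) * (1 - r γ 1) ≤
      Real.exp (1 + γ) * (r γ n - r γ (n + 1)) * (y - x) := by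
  have := increment_mul_le (a := r γ 1) (b := 1) (D := Real.exp (1 + γ))
    (fun z hz => hasDerivAt_iterate_root hγ ((r_pos hγ 1).trans_le hz.1) n)
    (fun z hz t ht => iterDeriv_le_mul hγ hz ht n) hx hxy hy le_rfl (r_one_lt hγ).le le_rfl
  rwa [iterate_root_r_one, ← r_eq_iterate] at this

omit hγ in
theorem rpow_le_two_rpow_abs_mul {s x y : ℝ} (hx : 0 < x) (hy : 0 < y) (hxy : x ≤ 2 * y)
    (hyx : y ≤ 2 * x) : x ^ s ≤ 2 ^ |s| * y ^ s := by
  rcases le_total 0 s with hs | hs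
  · rw [abs_of_nonneg hs, ← Real.mul_rpow two_pos.le hy.le]
    exact Real.rpow_le_rpow hx.le hxy hs
  · rw [abs_of_nonpos hs, Real.rpow_neg two_pos.le, ← Real.inv_rpow two_pos.le,
      ← Real.mul_rpow (by norm_num) hy.le]
    exact Real.rpow_le_rpow_of_nonpos (by linarith) (by linarith) hs

/-- On an interval whose endpoints have ratio at most `2`, the derivative of `x ^ γ` varies by a
factor of at most `2 ^ |γ - 1|`, whichever side of `1` the exponent is on. -/
theorem rpow_sub_mul_le {a₀ a b b₀ : ℝ} (h0 : 0 < a₀) (ha : a₀ ≤ a) (hab : a ≤ b) (hb : b ≤ b₀)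
    (hb0 : b₀ ≤ 2 * a₀) :
    (b ^ γ - a ^ γ) * (b₀ - a₀) ≤ 2 ^ |γ - 1| * (b₀ ^ γ - a₀ ^ γ) * (b - a) := by
  refine increment_mul_le (g := fun x => x ^ γ) (g' := fun x => γ * x ^ (γ - 1)) (a := a₀)
    (b := b₀) (fun z hz => Real.hasDerivAt_rpow_const (Or.inl (h0.trans_le hz.1).ne'))
    (fun z hz t ht => ?_) ha hab hb le_rfl (ha.trans (hab.trans hb)) le_rfl
  have := rpow_le_two_rpow_abs_mul (s := γ - 1) (h0.trans_le hz.1) (h0.trans_le ht.1)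
    (by linarith [hz.2, ht.1]) (by linarith [hz.1, ht.2])
  nlinarith

/-- Gains the factor `y - x` over the trivial bound `r n ^ γ - r (n+1) ^ γ` while remaining summable
in `n`. This is what makes distortion summable over compositions of branches. -/
theorem rpow_iterate_root_sub_le {x y : ℝ} (hx : r γ 1 ≤ x) (hxy : x ≤ y) (hy : y ≤ 1) (n : ℕ) :
    ((root γ)^[n] y) ^ γ - ((root γ)^[n] x) ^ γ ≤
      2 ^ |γ - 1| * Real.exp (1 + γ) / (1 - r γ 1) * (y - x) * (r γ n ^ γ - r γ (n + 1) ^ γ) := by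
  have h1 := iterate_root_mem hγ ⟨hx, hxy.trans hy⟩ n
  have h2 := iterate_root_mem hγ ⟨hx.trans hxy, hy⟩ n
  have hr0 := r_pos hγ (n + 1)
  have h3 := rpow_sub_mul_le hγ hr0 h1.1
    (iterate_root_le hγ ((r_pos hγ 1).le.trans hx) hxy n) h2.2 (r_le_two_mul hγ n)
  have h4 := iterate_root_sub_mul_le hγ hx hxy hy n
  have h5 : 0 < 1 - r γ 1 := sub_pos.2 (r_one_lt hγ)
  have h6 : 0 < r γ n - r γ (n + 1) := sub_pos.2 (r_succ_lt hγ n)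
  have h7 : 0 ≤ r γ n ^ γ - r γ (n + 1) ^ γ :=
    sub_nonneg.2 (Real.rpow_le_rpow hr0.le (r_succ_lt hγ n).le hγ.le)
  refine le_of_mul_le_mul_right ?_ (mul_pos h6 h5)
  set U := ((root γ)^[n] y) ^ γ - ((root γ)^[n] x) ^ γ
  set V := (root γ)^[n] y - (root γ)^[n] x
  set W := r γ n ^ γ - r γ (n + 1) ^ γ
  set Q : ℝ := 2 ^ |γ - 1| with hQ
  have hQ0 : 0 < Q := by positivity
  calc U * ((r γ n - r γ (n + 1)) * (1 - r γ 1))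
      = U * (r γ n - r γ (n + 1)) * (1 - r γ 1) := by ring
    _ ≤ Q * W * V * (1 - r γ 1) := mul_le_mul_of_nonneg_right h3 h5.le
    _ = Q * W * (V * (1 - r γ 1)) := by ring
    _ ≤ Q * W * (Real.exp (1 + γ) * (r γ n - r γ (n + 1)) * (y - x)) :=
        mul_le_mul_of_nonneg_left h4 (mul_nonneg hQ0.le h7)
    _ = _ := by field_simp

theorem branch_mem {y : ℝ} (hy : y ∈ Icc (r γ 1) 1) (m : ℕ) :
    branch γ m y ∈ Icc (r γ 1) 1 := by
  have h := iterate_root_mem hγ hy (m - 1)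
  have h0 := (r_pos hγ (m - 1 + 1)).le.trans h.1
  constructor
  · rw [branch, ← root_one]
    exact root_le_root hγ zero_le_one (by linarith)
  · exact (root_le_root hγ (by linarith) (by linarith [h.2, r_le_one hγ (m - 1)])).trans_eq
      (root_two hγ)

theorem branch_lt {x y : ℝ} (hx : 0 ≤ x) (hxy : x < y) (m : ℕ) : branch γ m x < branch γ m y :=
  root_lt_root hγ (by linarith [iterate_root_nonneg hγ hx (m - 1)])
    (by linarith [iterate_root_lt hγ hx hxy (m - 1)])

theorem hasDerivAt_branch {y : ℝ} (hy : 0 < y) (m : ℕ) :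
    HasDerivAt (branch γ m) (branchDeriv γ m y) y :=
  (hasDerivAt_root hγ (by linarith [iterate_root_pos hγ hy (m - 1)])).comp y
    ((hasDerivAt_iterate_root hγ hy (m - 1)).const_add 1)

theorem branchDeriv_pos {y : ℝ} (hy : y ∈ Icc (r γ 1) 1) (m : ℕ) : 0 < branchDeriv γ m y :=
  mul_pos (inv_pos.2 (stepDeriv_pos hγ ((r_pos hγ 1).le.trans (branch_mem hγ hy m).1)))
    (iterDeriv_pos hγ ((r_pos hγ 1).trans_le hy.1) _)

theorem branchDeriv_le {y : ℝ} (hy : y ∈ Icc (r γ 1) 1) (m : ℕ) :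
    branchDeriv γ m y ≤ (stepDeriv γ (r γ 1))⁻¹ := by
  have h0 := r_pos hγ 1
  have h1 := inv_anti₀ (stepDeriv_pos hγ h0.le) (stepDeriv_mono hγ h0.le (branch_mem hγ hy m).1)
  exact (mul_le_of_le_one_right
    (inv_pos.2 (stepDeriv_pos hγ (h0.le.trans (branch_mem hγ hy m).1))).le
    (iterDeriv_le_one hγ (h0.trans_le hy.1) _)).trans h1

theorem branch_sub_le {x y : ℝ} (hx : r γ 1 ≤ x) (hxy : x ≤ y) (hy : y ≤ 1) (m : ℕ) :
    branch γ m y - branch γ m x ≤ (stepDeriv γ (r γ 1))⁻¹ * (y - x) :=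
  sub_le_of_hasDerivAt_le hxy
    (fun _ hz => hasDerivAt_branch hγ ((r_pos hγ 1).trans_le (hx.trans hz.1)) m)
    fun _ hz => branchDeriv_le hγ ⟨hx.trans hz.1, hz.2.trans hy⟩ m

/-- The logarithm of the derivative of `branch` is Lipschitz, uniformly in the branch. -/
theorem exists_branchDeriv_le_exp_mul : ∃ L ≥ 0, ∀ m : ℕ, ∀ x y : ℝ, r γ 1 ≤ x → x ≤ y → y ≤ 1 →
    branchDeriv γ m x ≤ Real.exp (L * (y - x)) * branchDeriv γ m y ∧
      branchDeriv γ m y ≤ branchDeriv γ m x := by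
  have h5 : 0 < 1 - r γ 1 := sub_pos.2 (r_one_lt hγ)
  set K := 2 ^ |γ - 1| * Real.exp (1 + γ) / (1 - r γ 1) with hK
  have hK0 : 0 < K := by positivity
  refine ⟨(1 + γ) * (2 * K), by positivity, fun m x y hx hxy hy => ?_⟩
  have h0 := r_pos hγ 1
  have hbx := branch_mem hγ ⟨hx, hxy.trans hy⟩ m
  have hby := branch_mem hγ ⟨hx.trans hxy, hy⟩ m
  have hbxy : branch γ m x ≤ branch γ m y := by
    rcases hxy.eq_or_lt with rfl | h
    · exact le_rfl
    · exact (branch_lt hγ (h0.le.trans hx) h m).le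
  have hbx0 := h0.le.trans hbx.1
  have hpos1 := inv_pos.2 (stepDeriv_pos hγ hbx0)
  have hpos2 := inv_pos.2 (stepDeriv_pos hγ (hbx0.trans hbxy))
  have hpos3 := iterDeriv_pos hγ (h0.trans_le hx) (m - 1)
  have hpos4 := iterDeriv_pos hγ (h0.trans_le (hx.trans hxy)) (m - 1)
  constructor
  · have h1 := inv_stepDeriv_le hγ hbx0 hbxy
    have h2 := iterDeriv_le_exp_mul hγ (h0.trans_le hx) hxy (m - 1)
    have hsum : ∑ j ∈ Finset.range (m - 1),
        (((root γ)^[j + 1] y) ^ γ - ((root γ)^[j + 1] x) ^ γ) ≤ K * (y - x) := by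
      refine (Finset.sum_le_sum fun j _ =>
        rpow_iterate_root_sub_le hγ hx hxy hy (j + 1)).trans ?_
      rw [← Finset.mul_sum]
      exact mul_le_of_le_one_right (mul_nonneg hK0.le (by linarith)) (sum_rpow_sub_r_le_one hγ _)
    -- The outermost `root` in `branch` lands in `[r₁, 1]`, so the case `n = 0` applies to the
    -- images of `x` and `y`.
    have hlast : branch γ m y ^ γ - branch γ m x ^ γ ≤ K * (y - x) := by
      have h6 := rpow_iterate_root_sub_le hγ hbx.1 hbxy hby.2 0
      simp only [Function.iterate_zero, id_eq, zero_add] at h6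
      have h7 : r γ 0 ^ γ - r γ 1 ^ γ ≤ 1 := by
        have := Real.rpow_nonneg h0.le γ
        rw [r, Real.one_rpow]
        linarith
      have h8 : branch γ m y - branch γ m x ≤ y - x :=
        (branch_sub_le hγ hx hxy hy m).trans (mul_le_of_le_one_left (by linarith)
          (inv_le_one_of_one_le₀ (one_le_stepDeriv hγ h0.le)))
      refine h6.trans ((mul_le_of_le_one_right
        (mul_nonneg hK0.le (by linarith)) h7).trans (mul_le_mul_of_nonneg_left h8 hK0.le))
    calc branchDeriv γ m x ≤ (Real.exp ((1 + γ) * (branch γ m y ^ γ - branch γ m x ^ γ)) *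
            (stepDeriv γ (branch γ m y))⁻¹) * (Real.exp ((1 + γ) * ∑ j ∈ Finset.range (m - 1),
            (((root γ)^[j + 1] y) ^ γ - ((root γ)^[j + 1] x) ^ γ)) * iterDeriv γ (m - 1) y) :=
          mul_le_mul h1 h2 hpos3.le (by positivity)
      _ = Real.exp ((1 + γ) * ((branch γ m y ^ γ - branch γ m x ^ γ) +
            ∑ j ∈ Finset.range (m - 1), (((root γ)^[j + 1] y) ^ γ - ((root γ)^[j + 1] x) ^ γ))) *
            branchDeriv γ m y := by rw [mul_add, Real.exp_add, branchDeriv]; ring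
      _ ≤ _ := by
          refine mul_le_mul_of_nonneg_right (Real.exp_le_exp.2 ?_) (mul_pos hpos2 hpos4).le
          rw [mul_assoc]
          exact mul_le_mul_of_nonneg_left (by linarith) (by linarith)
  · exact mul_le_mul (inv_anti₀ (stepDeriv_pos hγ hbx0) (stepDeriv_mono hγ hbx0 hbxy))
      (iterDeriv_antitone hγ (h0.trans_le hx) hxy _) hpos4.le hpos1.le

/-! ### Compositions of inverse branches -/

omit hγ in
theorem wordBranch_append (σ τ : List ℕ) (y : ℝ) :
    wordBranch γ (σ ++ τ) y = wordBranch γ σ (wordBranch γ τ y) := by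
  induction σ with
  | nil => rfl
  | cons m σ ih => simp only [List.cons_append, wordBranch, ih]

theorem wordBranch_mem {y : ℝ} (hy : y ∈ Icc (r γ 1) 1) (σ : List ℕ) :
    wordBranch γ σ y ∈ Icc (r γ 1) 1 := by
  induction σ with
  | nil => exact hy
  | cons m σ ih => exact branch_mem hγ ih m

theorem wordBranch_lt {x y : ℝ} (hx : r γ 1 ≤ x) (hxy : x < y) (hy : y ≤ 1) (σ : List ℕ) :
    wordBranch γ σ x < wordBranch γ σ y := by
  induction σ with
  | nil => exact hxy
  | cons m σ ih =>
    exact branch_lt hγ ((r_pos hγ 1).le.trans (wordBranch_mem hγ ⟨hx, hxy.le.trans hy⟩ σ).1) ih m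

theorem wordBranch_le {x y : ℝ} (hx : r γ 1 ≤ x) (hxy : x ≤ y) (hy : y ≤ 1) (σ : List ℕ) :
    wordBranch γ σ x ≤ wordBranch γ σ y := by
  rcases hxy.eq_or_lt with rfl | h
  · exact le_rfl
  · exact (wordBranch_lt hγ hx h hy σ).le

theorem hasDerivAt_wordBranch {y : ℝ} (hy : y ∈ Icc (r γ 1) 1) (σ : List ℕ) :
    HasDerivAt (wordBranch γ σ) (wordDeriv γ σ y) y := by
  induction σ with
  | nil => exact hasDerivAt_id y
  | cons m σ ih =>
    exact (hasDerivAt_branch hγ ((r_pos hγ 1).trans_le (wordBranch_mem hγ hy σ).1) m).comp y ih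

theorem wordDeriv_pos {y : ℝ} (hy : y ∈ Icc (r γ 1) 1) (σ : List ℕ) : 0 < wordDeriv γ σ y := by
  induction σ with
  | nil => exact one_pos
  | cons m σ ih => exact mul_pos (branchDeriv_pos hγ (wordBranch_mem hγ hy σ) m) ih

theorem wordBranch_sub_le {x y : ℝ} (hx : r γ 1 ≤ x) (hxy : x ≤ y) (hy : y ≤ 1) (σ : List ℕ) :
    wordBranch γ σ y - wordBranch γ σ x ≤ (stepDeriv γ (r γ 1))⁻¹ ^ σ.length * (y - x) := by
  induction σ with
  | nil => simp [wordBranch]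
  | cons m σ ih =>
    have h1 := branch_sub_le hγ (wordBranch_mem hγ ⟨hx, hxy.trans hy⟩ σ).1
      (wordBranch_le hγ hx hxy hy σ) (wordBranch_mem hγ ⟨hx.trans hxy, hy⟩ σ).2 m
    refine h1.trans ?_
    rw [List.length_cons, pow_succ', mul_assoc]
    exact mul_le_mul_of_nonneg_left ih (inv_pos.2 (stepDeriv_pos hγ (r_pos hγ 1).le)).le

/-- Bounded distortion for all iterates of `F`. -/
theorem exists_wordDeriv_le_mul : ∃ D ≥ 1, ∀ σ : List ℕ, ∀ x ∈ Icc (r γ 1) 1,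
    ∀ y ∈ Icc (r γ 1) 1, wordDeriv γ σ x ≤ D * wordDeriv γ σ y := by
  obtain ⟨L, hL0, hL⟩ := exists_branchDeriv_le_exp_mul hγ
  set κ := (stepDeriv γ (r γ 1))⁻¹ with hκ
  have h0 := r_pos hγ 1
  have hκ0 : 0 < κ := inv_pos.2 (stepDeriv_pos hγ h0.le)
  have hκ1 : κ < 1 := by
    refine inv_lt_one_of_one_lt₀ ?_
    have := Real.rpow_pos_of_pos h0 γ
    rw [stepDeriv]
    nlinarith
  have key : ∀ σ : List ℕ, ∀ x y, r γ 1 ≤ x → x ≤ y → y ≤ 1 →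
      wordDeriv γ σ x ≤
        Real.exp (L * ∑ l ∈ Finset.range σ.length, κ ^ l) * wordDeriv γ σ y ∧
      wordDeriv γ σ y ≤ wordDeriv γ σ x := by
    intro σ x y hx hxy hy
    have hx' : x ∈ Icc (r γ 1) 1 := ⟨hx, hxy.trans hy⟩
    have hy' : y ∈ Icc (r γ 1) 1 := ⟨hx.trans hxy, hy⟩
    induction σ with
    | nil => simp [wordDeriv]
    | cons m σ ih =>
      have hwx := wordBranch_mem hγ hx' σ
      have hwy := wordBranch_mem hγ hy' σ
      obtain ⟨h1, h2⟩ := hL m _ _ hwx.1 (wordBranch_le hγ hx hxy hy σ) hwy.2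
      have h3 := wordBranch_sub_le hγ hx hxy hy σ
      rw [← hκ] at h3
      -- Each branch contracts by `κ < 1`, so the letter in front of `σ` contributes distortion at
      -- most `exp (L κ ^ |σ|)`, and the exponents form a geometric series.
      have h4 : wordBranch γ σ y - wordBranch γ σ x ≤ κ ^ σ.length :=
        h3.trans (mul_le_of_le_one_right (by positivity) (by linarith))
      have hb := branchDeriv_pos hγ hwy m
      constructor
      · calc wordDeriv γ (m :: σ) x
            ≤ (Real.exp (L * κ ^ σ.length) * branchDeriv γ m (wordBranch γ σ y)) *
              (Real.exp (L * ∑ l ∈ Finset.range σ.length, κ ^ l) * wordDeriv γ σ y) := by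
              refine mul_le_mul (h1.trans (mul_le_mul_of_nonneg_right (Real.exp_le_exp.2
                (mul_le_mul_of_nonneg_left h4 hL0)) hb.le)) ih.1 (wordDeriv_pos hγ hx' σ).le ?_
              positivity
          _ = _ := by
              rw [List.length_cons, Finset.sum_range_succ, mul_add, Real.exp_add, wordDeriv]
              ring
      · exact mul_le_mul h2 ih.2 (wordDeriv_pos hγ hy' σ).le (branchDeriv_pos hγ hwx m).le
  have hD : 0 ≤ L * (1 - κ)⁻¹ := mul_nonneg hL0 (inv_nonneg.2 (by linarith))
  refine ⟨Real.exp (L * (1 - κ)⁻¹), Real.one_le_exp hD, fun σ x hx y hy => ?_⟩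
  have hpos := (wordDeriv_pos hγ hy σ).le
  rcases le_total x y with hxy | hxy
  · refine (key σ x y hx.1 hxy hy.2).1.trans
      (mul_le_mul_of_nonneg_right (Real.exp_le_exp.2 (mul_le_mul_of_nonneg_left ?_ hL0)) hpos)
    rw [← tsum_geometric_of_lt_one hκ0.le hκ1]
    exact (summable_geometric_of_lt_one hκ0.le hκ1).sum_le_tsum _ fun _ _ => by positivity
  · exact (key σ y x hy.1 hxy hx.2).2.trans (le_mul_of_one_le_left hpos (Real.one_le_exp hD))

/-- Inverse branches distort ratios of lengths by a bounded factor. -/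
theorem exists_wordBranch_sub_mul_le : ∃ D ≥ 1, ∀ σ : List ℕ, ∀ x y z t : ℝ,
    r γ 1 ≤ x → x ≤ y → y ≤ 1 → r γ 1 ≤ z → z ≤ t → t ≤ 1 →
    (wordBranch γ σ y - wordBranch γ σ x) * (t - z) ≤
      D * (wordBranch γ σ t - wordBranch γ σ z) * (y - x) := by
  obtain ⟨D, hD1, hD⟩ := exists_wordDeriv_le_mul hγ
  exact ⟨D, hD1, fun σ x y z t hx hxy hy hz hzt ht =>
    increment_mul_le (fun s hs => hasDerivAt_wordBranch hγ hs σ) (hD σ) hx hxy hy hz hzt ht⟩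

end

section
variable {γ : ℝ} (hγ : 0 < γ)
include hγ

/-! ### The first return map and its inverse branches -/

theorem iterate_root_lt_r {y : ℝ} (hy : y ∈ Ico (r γ 1) 1) (n : ℕ) :
    (root γ)^[n] y < r γ n := by
  rw [r_eq_iterate]
  exact iterate_root_lt hγ ((r_pos hγ 1).le.trans hy.1) hy.2 n

theorem f_iterate_root_succ {y : ℝ} (hy : y ∈ Ico (r γ 1) 1) (n : ℕ) :
    f γ ((root γ)^[n + 1] y) = (root γ)^[n] y := by
  have h : (root γ)^[n + 1] y < r γ 1 :=
    (iterate_root_lt_r hγ hy (n + 1)).trans_le (r_antitone hγ (by omega))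
  rw [f, if_pos h, Function.iterate_succ_apply']
  exact step_root hγ (iterate_root_nonneg hγ ((r_pos hγ 1).le.trans hy.1) n)

theorem iterate_f_iterate_root {y : ℝ} (hy : y ∈ Ico (r γ 1) 1) (n k : ℕ) :
    (f γ)^[k] ((root γ)^[n + k] y) = (root γ)^[n] y := by
  induction k with
  | zero => rfl
  | succ k ih => rw [← add_assoc, Function.iterate_succ_apply, f_iterate_root_succ hγ hy, ih]

theorem f_branch {y : ℝ} (hy : y ∈ Icc (r γ 1) 1) (m : ℕ) :
    f γ (branch γ m y) = (root γ)^[m - 1] y := by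
  have h := (branch_mem hγ hy m).1
  have h1 := step_root hγ (show 0 ≤ 1 + (root γ)^[m - 1] y by
    linarith [iterate_root_nonneg hγ ((r_pos hγ 1).le.trans hy.1) (m - 1)])
  rw [f, if_neg h.not_gt]
  change step γ (branch γ m y) - 1 = _
  rw [branch, h1]
  ring

/-- Before time `m` the orbit runs through `(root γ)^[j] y` with `j ≥ 1`, all below `r₁`. For `y =
1` and `m ≥ 2` it would hit `r₁` one step early, hence the half-open interval. -/
theorem returnTime_branch {y : ℝ} (hy : y ∈ Ico (r γ 1) 1) {m : ℕ} (hm : 1 ≤ m) :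
    returnTime γ (branch γ m y) = m ∧ (f γ)^[m] (branch γ m y) = y := by
  obtain ⟨m, rfl⟩ := Nat.exists_eq_add_of_le' hm
  have hy' := Ico_subset_Icc_self hy
  have hret : (f γ)^[m + 1] (branch γ (m + 1) y) = y := by
    have := iterate_f_iterate_root hγ hy 0 m
    rw [Function.iterate_succ_apply, f_branch hγ hy', Nat.add_sub_cancel]
    simpa using this
  refine ⟨IsLeast.csInf_eq ⟨⟨hm, by rwa [hret]⟩, fun k ⟨hk, hk'⟩ => ?_⟩, hret⟩
  by_contra! hlt
  obtain ⟨k, rfl⟩ := Nat.exists_eq_add_of_le' hk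
  obtain ⟨j, hj⟩ := Nat.exists_eq_add_of_lt (show k < m by omega)
  rw [Function.iterate_succ_apply, f_branch hγ hy', Nat.add_sub_cancel,
    show m = j + 1 + k by omega, iterate_f_iterate_root hγ hy] at hk'
  exact hk'.1.not_gt ((iterate_root_lt_r hγ hy (j + 1)).trans_le (r_antitone hγ (by omega)))

theorem F_branch {y : ℝ} (hy : y ∈ Ico (r γ 1) 1) {m : ℕ} (hm : 1 ≤ m) :
    F γ (branch γ m y) = y := by
  obtain ⟨h1, h2⟩ := returnTime_branch hγ hy hm
  rw [F, h1, h2]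

theorem branch_r_one {m : ℕ} (hm : 1 ≤ m) : branch γ m (r γ 1) = p γ m := by
  rw [branch, iterate_root_r_one, Nat.sub_add_cancel hm, p_eq hγ]

theorem branch_one (m : ℕ) : branch γ m 1 = p γ (m - 1) := by
  rw [branch, ← r_eq_iterate, p_eq hγ]

theorem branch_mem_Ico {y : ℝ} (hy : y ∈ Ico (r γ 1) 1) {m : ℕ} (hm : 1 ≤ m) :
    branch γ m y ∈ Ico (p γ m) (p γ (m - 1)) := by
  have h0 := (r_pos hγ 1).le
  rw [← branch_r_one hγ hm, ← branch_one hγ]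
  refine ⟨?_, branch_lt hγ (h0.trans hy.1) hy.2 m⟩
  rcases hy.1.eq_or_lt with h | h
  · rw [← h]
  · exact (branch_lt hγ h0 h m).le

theorem exists_branch_eq {x : ℝ} {m : ℕ} (hm : 1 ≤ m) (hx : x ∈ Ico (p γ m) (p γ (m - 1))) :
    ∃ y ∈ Ico (r γ 1) 1, branch γ m y = x := by
  rw [← branch_r_one hγ hm, ← branch_one hγ] at hx
  exact intermediate_value_Ico (r_one_lt hγ).le (fun z hz =>
    (hasDerivAt_branch hγ ((r_pos hγ 1).trans_le hz.1) m).continuousAt.continuousWithinAt) hx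

theorem F_one : F γ 1 = 1 := by
  have h : f γ 1 = 1 := by
    rw [f, if_neg (r_one_lt hγ).not_gt, Real.one_rpow]
    ring
  exact Function.iterate_fixed h _

theorem cylinder_eq_image (σ : List ℕ) (hσ : ∀ m ∈ σ, 1 ≤ m) :
    {x | x ∈ Ico (r γ 1) 1 ∧
      ∀ i : Fin σ.length, (F γ)^[(i : ℕ)] x ∈ Ico (p γ (σ.get i)) (p γ (σ.get i - 1))} =
      wordBranch γ σ '' Ico (r γ 1) 1 := by
  induction σ with
  | nil =>
    ext x
    simp [wordBranch]
  | cons m σ ih =>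
    have hm : 1 ≤ m := hσ m (by simp)
    have ih' := fun x => Set.ext_iff.1 (ih fun k hk => hσ k (by simp [hk])) x
    ext x
    constructor
    · rintro ⟨-, hx⟩
      have h0 := hx ⟨0, by simp⟩
      obtain ⟨y, hy, rfl⟩ := exists_branch_eq hγ hm h0
      obtain ⟨z, hz, hzy⟩ := (ih' y).1 ⟨hy, fun i => by
        have := hx i.succ
        rwa [Fin.val_succ, Function.iterate_succ_apply, F_branch hγ hy hm] at this⟩
      exact ⟨z, hz, by rw [wordBranch, hzy]⟩
    · rintro ⟨z, hz, rfl⟩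
      obtain ⟨h1, h2⟩ := (ih' _).2 ⟨z, hz, rfl⟩
      have h3 := branch_mem_Ico hγ h1 hm
      refine ⟨⟨(p_mem_Icc hγ m).1.trans h3.1, h3.2.trans_le (p_mem_Icc hγ _).2⟩, fun i => ?_⟩
      refine Fin.cases ?_ (fun j => ?_) i
      · exact h3
      · have := h2 j
        rw [← F_branch hγ h1 hm] at this
        rwa [Fin.val_succ, Function.iterate_succ_apply]

theorem basicInterval_eq {σ : List ℕ} (hne : σ ≠ []) (hσ : ∀ m ∈ σ, 1 ≤ m) :
    basicInterval γ σ = Icc (wordBranch γ σ (r γ 1)) (wordBranch γ σ 1) := by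
  -- A nonempty word already excludes the point `1`, since its first condition gives `x < p (m - 1)
  -- ≤ 1`.
  have hset : {x | x ∈ Icc (r γ 1) 1 ∧
      ∀ i : Fin σ.length, (F γ)^[(i : ℕ)] x ∈ Ico (p γ (σ.get i)) (p γ (σ.get i - 1))} =
      wordBranch γ σ '' Ico (r γ 1) 1 := by
    rw [← cylinder_eq_image hγ σ hσ]
    ext x
    refine ⟨fun ⟨h1, h2⟩ => ⟨⟨h1.1, ?_⟩, h2⟩, fun ⟨h1, h2⟩ => ⟨Ico_subset_Icc_self h1, h2⟩⟩
    exact (h2 ⟨0, List.length_pos_iff.2 hne⟩).2.trans_le (p_mem_Icc hγ _).2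
  have hlt := r_one_lt hγ
  have hcont : ContinuousOn (wordBranch γ σ) (Icc (r γ 1) 1) := fun z hz =>
    (hasDerivAt_wordBranch hγ hz σ).continuousAt.continuousWithinAt
  rw [basicInterval, hset]
  refine subset_antisymm (closure_minimal ?_ isClosed_Icc) ?_
  · rintro _ ⟨y, hy, rfl⟩
    exact ⟨wordBranch_le hγ le_rfl hy.1 hy.2.le σ, wordBranch_le hγ hy.1 hy.2.le le_rfl σ⟩
  · refine (intermediate_value_Icc hlt.le hcont).trans ?_
    rw [← closure_Ico hlt.ne] at hcont ⊢
    exact hcont.image_closure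

theorem basicInterval_append {σ : List ℕ} (hσ : ∀ m ∈ σ, 1 ≤ m) {k : ℕ} (hk : 1 ≤ k) :
    basicInterval γ (σ ++ [k]) = Icc (wordBranch γ σ (p γ k)) (wordBranch γ σ (p γ (k - 1))) := by
  rw [basicInterval_eq hγ (by simp) (by simpa [or_imp, forall_and] using ⟨hσ, hk⟩),
    wordBranch_append, wordBranch_append]
  simp only [wordBranch, branch_r_one hγ hk, branch_one hγ]

theorem tendsto_r : Filter.Tendsto (r γ) Filter.atTop (nhds 0) := by
  obtain ⟨c, -, C, -, h⟩ := exists_r_bounds hγ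
  have h1 : Filter.Tendsto (fun n : ℕ => C * (n : ℝ) ^ (-(1 / γ))) Filter.atTop (nhds 0) := by
    simpa using ((tendsto_rpow_neg_atTop (one_div_pos.2 hγ)).comp
      tendsto_natCast_atTop_atTop).const_mul C
  refine tendsto_of_tendsto_of_tendsto_of_le_of_le' tendsto_const_nhds h1
    (Filter.Eventually.of_forall fun n => (r_pos hγ n).le) ?_
  filter_upwards [Filter.eventually_ge_atTop 1] with n hn using (h n hn).2

theorem tendsto_p : Filter.Tendsto (p γ) Filter.atTop (nhds (r γ 1)) := by
  refine tendsto_of_tendsto_of_tendsto_of_le_of_le tendsto_const_nhds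
    (by simpa using (tendsto_r hγ).const_add (r γ 1)) (fun n => (r_one_lt_p hγ n).le)
    fun n => ?_
  linarith [p_sub_le hγ n]

omit hγ in
/-- If a sequence decreases to `l`, the intervals between its consecutive terms fill `(l, q k]`. -/
theorem exists_mem_Icc_of_tendsto {q : ℕ → ℝ} {l z : ℝ}
    (hq : Filter.Tendsto q Filter.atTop (nhds l)) {k : ℕ} (hk : 1 ≤ k)
    (hz : z ∈ Ioc l (q (k - 1))) : ∃ i, k ≤ i ∧ z ∈ Icc (q i) (q (i - 1)) := by
  classical
  have hex : ∃ i, k ≤ i ∧ q i ≤ z :=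
    ((Filter.eventually_ge_atTop k).and (hq.eventually_le_const hz.1)).exists
  obtain ⟨h1, h2⟩ := Nat.find_spec hex
  refine ⟨Nat.find hex, h1, h2, ?_⟩
  rcases h1.eq_or_lt with h | h
  · rw [← h]
    exact hz.2
  · have := Nat.find_min hex (Nat.sub_lt (by omega) one_pos)
    push Not at this
    exact (this (by omega)).le

theorem iUnion_basicInterval {σ : List ℕ} (hσ : ∀ m ∈ σ, 1 ≤ m) {k : ℕ} (hk : 1 ≤ k) :
    ⋃ i ∈ Ici k, basicInterval γ (σ ++ [i]) =
      Ioc (wordBranch γ σ (r γ 1)) (wordBranch γ σ (p γ (k - 1))) := by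
  ext z
  simp only [mem_iUnion, mem_Ici, exists_prop]
  constructor
  · rintro ⟨i, hi, hz⟩
    rw [basicInterval_append hγ hσ (hk.trans hi)] at hz
    exact ⟨(wordBranch_lt hγ le_rfl (r_one_lt_p hγ i) (p_mem_Icc hγ i).2 σ).trans_le hz.1,
      hz.2.trans (wordBranch_le hγ (p_mem_Icc hγ _).1 (p_antitone hγ (by omega))
        (p_mem_Icc hγ _).2 σ)⟩
  · intro hz
    have hcont := (hasDerivAt_wordBranch hγ ⟨le_rfl, (r_one_lt hγ).le⟩ σ).continuousAt
    obtain ⟨i, hi, hi'⟩ := exists_mem_Icc_of_tendsto (q := fun i => wordBranch γ σ (p γ i))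
      (hcont.tendsto.comp (tendsto_p hγ)) hk hz
    exact ⟨i, hi, by rwa [basicInterval_append hγ hσ (hk.trans hi)]⟩

/-! ### Length estimates for basic intervals -/

omit hγ in
theorem div_bounds_of_increment {X J a d D c t s : ℝ} (hJ : 0 < J) (ha : 0 < a) (hD : 0 < D)
    (hup : X * a ≤ D * J * d) (hlow : J * d ≤ D * X * a) (ht : d ≤ c * s) (hs : t * s ≤ d) :
    t / (D * a) * s ≤ X / J ∧ X / J ≤ D * c / a * s := by
  constructor
  · rw [le_div_iff₀ hJ, div_mul_eq_mul_div, div_mul_eq_mul_div, div_le_iff₀ (mul_pos hD ha)]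
    nlinarith
  · rw [div_le_iff₀ hJ, div_mul_eq_mul_div, div_mul_eq_mul_div, le_div_iff₀ ha]
    refine hup.trans ?_
    nlinarith [mul_pos hD hJ]

theorem exists_lengthEstimates : ∃ C : ℝ, 1 < C ∧ LengthEstimates γ C := by
  obtain ⟨D, hD1, hD⟩ := exists_wordBranch_sub_mul_le hγ
  obtain ⟨c, hc, C, hC, hr⟩ := exists_r_bounds hγ
  have hD0 : 0 < D := by linarith
  have ha : 0 < 1 - r γ 1 := sub_pos.2 (r_one_lt hγ)
  have hg : 0 < 2 + γ := by linarith
  set a := 1 - r γ 1 with ha_def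
  -- Lower (`u`) and upper (`v`) constants for the tail and for the single interval. The factor `2`
  -- in `v₁` is needed because the tail from `k` ends at `p (k - 1)`, governed by `r (k - 1) ≤ 2 r
  -- k`.
  set u₁ := c / (2 + γ) / (D * a) with hu₁
  set u₂ := c ^ (1 + γ) / (2 + γ) / (D * a) with hu₂
  set v₁ := D * (2 * C) / a with hv₁
  set v₂ := D * C ^ (1 + γ) / a with hv₂
  have hu₁0 : 0 < u₁ := by positivity
  have hu₂0 : 0 < u₂ := by positivity
  have hv₁0 : 0 < v₁ := by positivity
  have hv₂0 : 0 < v₂ := by positivity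
  have hi₁ := inv_pos.2 hu₁0
  have hi₂ := inv_pos.2 hu₂0
  set C₅ := 2 + u₁⁻¹ + u₂⁻¹ + v₁ + v₂ with hC₅
  have hl₁ : C₅⁻¹ ≤ u₁ := inv_le_of_inv_le₀ hu₁0 (by linarith)
  have hl₂ : C₅⁻¹ ≤ u₂ := inv_le_of_inv_le₀ hu₂0 (by linarith)
  refine ⟨C₅, by linarith, fun σ hne hσ k hk => ?_⟩
  have hk0 : (0 : ℝ) < k := by exact_mod_cast hk
  obtain ⟨h1, h2⟩ := hr k hk
  have hlt := r_one_lt hγ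
  have hJ : 0 < wordBranch γ σ 1 - wordBranch γ σ (r γ 1) :=
    sub_pos.2 (wordBranch_lt hγ le_rfl hlt le_rfl σ)
  obtain ⟨n, rfl⟩ := Nat.exists_eq_add_of_le' hk
  have hpn := p_mem_Icc hγ n
  have hpn' := p_mem_Icc hγ (n + 1)
  have hpp := (p_succ_lt hγ n).le
  rw [iUnion_basicInterval hγ hσ hk, basicInterval_append hγ hσ hk, basicInterval_eq hγ hne hσ,
    Real.diam_Ioc (wordBranch_le hγ le_rfl (p_mem_Icc hγ _).1 (p_mem_Icc hγ _).2 σ),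
    Real.diam_Icc (wordBranch_le hγ le_rfl hlt.le le_rfl σ), Nat.add_sub_cancel,
    Real.diam_Icc (wordBranch_le hγ hpn'.1 hpp hpn.2 σ)]
  set s : ℝ := ((n + 1 : ℕ) : ℝ) ^ (-(1 / γ)) with hs
  have hs0 : 0 < s := by positivity
  have hs' : ((n + 1 : ℕ) : ℝ) ^ (-1 - 1 / γ) = s ^ (1 + γ) := by
    rw [hs, ← Real.rpow_mul hk0.le]
    congr 1
    field_simp
    ring
  rw [hs']
  have hs0' : 0 < s ^ (1 + γ) := by positivity
  have hr0 := r_pos hγ (n + 1)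
  constructor
  · obtain ⟨hA, hB⟩ := div_bounds_of_increment (c := 2 * C) (t := c / (2 + γ)) (s := s) hJ ha hD0
      (hD σ _ _ _ _ le_rfl hpn.1 hpn.2 le_rfl hlt.le le_rfl)
      (hD σ _ _ _ _ le_rfl hlt.le le_rfl le_rfl hpn.1 hpn.2)
      (by linarith [p_sub_le hγ n, r_le_two_mul hγ n]) (by
        rw [div_mul_eq_mul_div, div_le_iff₀ hg]
        linarith [le_p_sub hγ n, r_succ_lt hγ n])
    exact ⟨(mul_le_mul_of_nonneg_right hl₁ hs0.le).trans hA,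
      hB.trans (mul_le_mul_of_nonneg_right (by linarith) hs0.le)⟩
  · obtain ⟨hA, hB⟩ := div_bounds_of_increment (c := C ^ (1 + γ)) (t := c ^ (1 + γ) / (2 + γ))
      (s := s ^ (1 + γ)) hJ ha hD0
      (hD σ _ _ _ _ hpn'.1 hpp hpn.2 le_rfl hlt.le le_rfl)
      (hD σ _ _ _ _ le_rfl hlt.le le_rfl hpn'.1 hpp hpn.2)
      (by
        rw [← Real.mul_rpow hC.le hs0.le]
        exact (p_sub_p_le hγ n).trans (Real.rpow_le_rpow hr0.le h2 (by linarith)))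
      (by
        rw [div_mul_eq_mul_div, div_le_iff₀ hg, ← Real.mul_rpow hc.le hs0.le, mul_comm (_ - _)]
        exact (Real.rpow_le_rpow (by positivity) h1 (by linarith)).trans (le_p_sub_p hγ n))
    exact ⟨(mul_le_mul_of_nonneg_right hl₂ hs0'.le).trans hA,
      hB.trans (mul_le_mul_of_nonneg_right (by linarith) hs0'.le)⟩

/-! ### Position of the left endpoints of basic intervals -/

omit hγ in
theorem exists_append_or_branching {α : Type*} (σ τ : List α) :
    (∃ ρ, τ = σ ++ ρ) ∨ (∃ ρ, σ = τ ++ ρ) ∨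
      ∃ ρ m n σ' τ', m ≠ n ∧ σ = ρ ++ m :: σ' ∧ τ = ρ ++ n :: τ' := by
  induction σ generalizing τ with
  | nil => exact Or.inl ⟨τ, rfl⟩
  | cons m σ ih =>
    cases τ with
    | nil => exact Or.inr (Or.inl ⟨m :: σ, rfl⟩)
    | cons n τ =>
      by_cases h : m = n
      · subst h
        rcases ih τ with ⟨ρ, rfl⟩ | ⟨ρ, rfl⟩ | ⟨ρ, m', n', σ', τ', h, rfl, rfl⟩
        · exact Or.inl ⟨ρ, rfl⟩
        · exact Or.inr (Or.inl ⟨ρ, rfl⟩)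
        · exact Or.inr (Or.inr ⟨m :: ρ, m', n', σ', τ', h, rfl, rfl⟩)
      · exact Or.inr (Or.inr ⟨[], m, n, σ, τ, h, rfl, rfl⟩)

theorem wordBranch_cons_mem {y : ℝ} (hy : y ∈ Icc (r γ 1) 1) {m : ℕ} (hm : 1 ≤ m) (σ : List ℕ) :
    wordBranch γ (m :: σ) y ∈ Icc (p γ m) (p γ (m - 1)) := by
  have h := wordBranch_mem hγ hy σ
  have h0 := (r_pos hγ 1).le
  rw [← branch_r_one hγ hm, ← branch_one hγ]
  constructor
  · rcases h.1.eq_or_lt with h' | h'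
    · rw [wordBranch, ← h']
    · exact (branch_lt hγ h0 h' m).le
  · rcases h.2.eq_or_lt with h' | h'
    · rw [wordBranch, h']
    · exact (branch_lt hγ (h0.trans h.1) h' m).le

/-- Two basic intervals have close left endpoints only if the shorter of them is short. -/
theorem exists_min_length_le : ∃ M > 0, ∀ σ τ : List ℕ, (∀ m ∈ σ, 1 ≤ m) → (∀ m ∈ τ, 1 ≤ m) →
    wordBranch γ σ (r γ 1) < wordBranch γ τ (r γ 1) →
    min (wordBranch γ σ 1 - wordBranch γ σ (r γ 1))
      (wordBranch γ τ 1 - wordBranch γ τ (r γ 1)) ≤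
      M * (wordBranch γ τ (r γ 1) - wordBranch γ σ (r γ 1)) := by
  obtain ⟨D, hD1, hD⟩ := exists_wordBranch_sub_mul_le hγ
  have hlt := r_one_lt hγ
  have hM : 1 ≤ D * (2 + γ) := by nlinarith
  refine ⟨D * (2 + γ), by linarith, fun σ τ hσ hτ hστ => ?_⟩
  have hl : r γ 1 ∈ Icc (r γ 1) 1 := ⟨le_rfl, hlt.le⟩
  have hr : (1 : ℝ) ∈ Icc (r γ 1) 1 := ⟨hlt.le, le_rfl⟩
  rcases exists_append_or_branching σ τ with ⟨ρ, rfl⟩ | ⟨ρ, rfl⟩ | ⟨ρ, m, n, σ', τ', hmn, rfl, rfl⟩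
  -- If `τ` properly extends `σ` by a word starting with `m`, its interval lies in the image of `[p
  -- m, p (m - 1)]`, whose length is at most `2 + γ` times the gap `p m - r₁`. Distortion transports
  -- this comparison through `σ`.
  · refine (min_le_right _ _).trans ?_
    cases ρ with
    | nil => simp at hστ
    | cons m ρ =>
      have hm : 1 ≤ m := hτ m (by simp)
      simp only [wordBranch_append]
      have h1 := wordBranch_cons_mem hγ hl hm ρ
      have h2 := wordBranch_cons_mem hγ hr hm ρ
      obtain ⟨n, rfl⟩ := Nat.exists_eq_add_of_le' hm
      rw [Nat.add_sub_cancel] at h1 h2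
      have hpn := p_mem_Icc hγ n
      have hpn' := p_mem_Icc hγ (n + 1)
      have h3 := wordBranch_le hγ (hpn'.1.trans h2.1) h2.2 hpn.2 σ
      have h4 := wordBranch_le hγ hpn'.1 h1.1 (h1.2.trans hpn.2) σ
      have h5 := hD σ _ _ _ _ hpn'.1 (p_succ_lt hγ n).le hpn.2 le_rfl hpn'.1 hpn'.2
      have h6 : p γ n - p γ (n + 1) ≤ (2 + γ) * (p γ (n + 1) - r γ 1) := by
        refine (p_sub_p_le hγ n).trans (le_trans ?_ (le_p_sub hγ (n + 1)))
        have hr0 := r_pos hγ (n + 1)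
        rw [Real.rpow_add hr0, Real.rpow_one]
        exact mul_le_of_le_one_right hr0.le (Real.rpow_le_one hr0.le (r_le_one hγ _) hγ.le)
      have h7 : 0 < p γ (n + 1) - r γ 1 := sub_pos.2 (r_one_lt_p hγ _)
      have h8 : 0 ≤ wordBranch γ σ (p γ (n + 1)) - wordBranch γ σ (r γ 1) :=
        sub_nonneg.2 (wordBranch_le hγ le_rfl hpn'.1 hpn'.2 σ)
      have h9 : wordBranch γ σ (p γ n) - wordBranch γ σ (p γ (n + 1)) ≤
          D * (2 + γ) * (wordBranch γ σ (p γ (n + 1)) - wordBranch γ σ (r γ 1)) := by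
        refine le_of_mul_le_mul_right (h5.trans ((mul_le_mul_of_nonneg_left h6
          (mul_nonneg (by linarith) h8)).trans_eq ?_)) h7
        ring
      nlinarith
  · rw [wordBranch_append] at hστ
    exact absurd (wordBranch_le hγ le_rfl (wordBranch_mem hγ hl ρ).1 (wordBranch_mem hγ hl ρ).2 τ)
      hστ.not_ge
  · refine (min_le_left _ _).trans ?_
    have hm : 1 ≤ m := hσ m (by simp)
    have hn : 1 ≤ n := hτ n (by simp)
    simp only [wordBranch_append] at hστ ⊢
    have h1 := wordBranch_cons_mem hγ hl hm σ'
    have h2 := wordBranch_cons_mem hγ hr hm σ'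
    have h3 := wordBranch_cons_mem hγ hl hn τ'
    have hm' := wordBranch_mem hγ hl (m :: σ')
    have hm'' := wordBranch_mem hγ hr (m :: σ')
    have hn' := wordBranch_mem hγ hl (n :: τ')
    -- At the first differing letter the larger one lies further left, as `p` decreases. So the
    -- whole interval of `σ` lies to the left of that of `τ`, and its length is at most the distance
    -- of the left endpoints.
    rcases hmn.lt_or_gt with h | h
    · have h4 : p γ (n - 1) ≤ p γ m := p_antitone hγ (by omega)
      exact absurd (wordBranch_le hγ hn'.1 (h3.2.trans (h4.trans h1.1)) hm'.2 ρ) hστ.not_ge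
    · have h4 : p γ (m - 1) ≤ p γ n := p_antitone hγ (by omega)
      have h5 := wordBranch_le hγ hm''.1 (h2.2.trans (h4.trans h3.1)) hn'.2 ρ
      nlinarith

/-! ### Points whose orbit avoids a neighbourhood of `r₁` -/

theorem mem_EF_of_forall_notMem {K : ℕ} (hK : 1 ≤ K) {w : ℝ} (hw : w ∈ Icc (r γ 1) 1)
    (h : ∀ σ : List ℕ, (∀ m ∈ σ, 1 ≤ m) →
      w ∉ Icc (wordBranch γ σ (r γ 1)) (wordBranch γ σ (p γ K))) : w ∈ EF γ := by
  refine ⟨hw, p γ K - r γ 1, sub_pos.2 (r_one_lt_p hγ K), fun n => ?_⟩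
  rw [add_sub_cancel]
  -- The point `1` lies in no half-open branch interval, but it is fixed by `F` and `p K < 1` as `K
  -- ≥ 1`.
  rcases hw.2.eq_or_lt with rfl | hw1
  · rw [Function.iterate_fixed (F_one hγ)]
    have : p γ K < 1 := (p_antitone hγ hK).trans_lt (p_succ_lt hγ 0)
    exact fun hmem => this.not_gt hmem.2
  have hlarge : ∀ σ : List ℕ, (∀ m ∈ σ, 1 ≤ m) → ∀ z ∈ Ico (r γ 1) 1, w = wordBranch γ σ z →
      p γ K < z := by
    intro σ hσ z hz hwz
    by_contra! hzK
    refine h σ hσ ?_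
    rw [hwz]
    exact ⟨wordBranch_le hγ le_rfl hz.1 hz.2.le σ,
      wordBranch_le hγ hz.1 hzK (p_mem_Icc hγ K).2 σ⟩
  -- An iterate beyond `p K` and below `1` lies in some `[p m, p (m - 1))`, so the coding of `w`
  -- extends by one letter. In particular `r₁`, where `F` is conventional, is never reached.
  have key : ∃ σ : List ℕ, (∀ m ∈ σ, 1 ≤ m) ∧ (F γ)^[n] w ∈ Ico (r γ 1) 1 ∧
      w = wordBranch γ σ ((F γ)^[n] w) := by
    induction n with
    | zero => exact ⟨[], by simp, ⟨hw.1, hw1⟩, rfl⟩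
    | succ n ih =>
      obtain ⟨σ, hσ, hz, hwz⟩ := ih
      set z := (F γ)^[n] w with hz_def
      have hzK := hlarge σ hσ z hz hwz
      obtain ⟨m, hm, hzm, hzm'⟩ : ∃ m, 1 ≤ m ∧ z ∈ Ico (p γ m) (p γ (m - 1)) := by
        classical
        have hex : ∃ i, p γ i ≤ z := ⟨K, hzK.le⟩
        have h1 : 1 ≤ Nat.find hex := by
          by_contra! h0
          have := Nat.find_spec hex
          rw [Nat.lt_one_iff.1 h0, p] at this
          exact this.not_gt hz.2
        exact ⟨Nat.find hex, h1, Nat.find_spec hex,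
          not_le.1 (Nat.find_min hex (Nat.sub_lt h1 one_pos))⟩
      obtain ⟨y, hy, hyz⟩ := exists_branch_eq hγ hm ⟨hzm, hzm'⟩
      have hF : (F γ)^[n + 1] w = y := by
        rw [Function.iterate_succ_apply', ← hz_def, ← hyz, F_branch hγ hy hm]
      refine ⟨σ ++ [m], by simpa [or_imp, forall_and] using ⟨hσ, hm⟩, by rwa [hF], ?_⟩
      rw [hF, wordBranch_append, hwz]
      simp only [wordBranch, hyz]
  obtain ⟨σ, hσ, hz, hwz⟩ := key
  exact fun hmem => (hlarge σ hσ _ hz hwz).not_gt hmem.2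

theorem isAlphaStrongWinning_EF :
    SchmidtGame.IsAlphaStrongWinning (1 / 4) (Icc (r γ 1) 1) (EF γ) := by
  obtain ⟨D, hD1, hD⟩ := exists_wordBranch_sub_mul_le hγ
  obtain ⟨M, hM, hsep⟩ := exists_min_length_le hγ
  have hlt := r_one_lt hγ
  have hl : r γ 1 ∈ Icc (r γ 1) 1 := ⟨le_rfl, hlt.le⟩
  have hr : (1 : ℝ) ∈ Icc (r γ 1) 1 := ⟨hlt.le, le_rfl⟩
  have ha : 0 < 1 - r γ 1 := sub_pos.2 hlt
  refine SchmidtGame.isAlphaStrongWinning_quarter (ι := {σ : List ℕ // ∀ m ∈ σ, 1 ≤ m})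
    (a := fun σ => wordBranch γ σ (r γ 1))
    (ℓ := fun σ => wordBranch γ σ 1 - wordBranch γ σ (r γ 1)) (L := 1) hM (fun σ => ?_)
    (fun σ τ => hsep σ τ σ.2 τ.2) fun η hη w hw hw' => ?_
  · linarith [(wordBranch_mem hγ hl σ).1, (wordBranch_mem hγ hr σ).2, r_pos hγ 1]
  -- `K` is chosen with `D (p K - r₁) ≤ η (1 - r₁)`. By distortion the image of `[r₁, p K]` then
  -- lies in the first `η`-fraction of every interval of the family.
  obtain ⟨K, hK, hK'⟩ := ((Filter.eventually_ge_atTop 1).and ((tendsto_p hγ).eventually_le_const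
    (show r γ 1 < r γ 1 + η * (1 - r γ 1) / D by
      have : 0 < η * (1 - r γ 1) / D := by positivity
      linarith))).exists
  refine mem_EF_of_forall_notMem hγ hK hw fun σ hσ hmem => ?_
  have hJ : 0 < wordBranch γ σ 1 - wordBranch γ σ (r γ 1) :=
    sub_pos.2 (wordBranch_lt hγ le_rfl hlt le_rfl σ)
  refine hw' ⟨σ, hσ⟩ hJ ⟨hmem.1, hmem.2.trans ?_⟩
  have hpK := p_mem_Icc hγ K
  have h1 := hD σ _ _ _ _ le_rfl hpK.1 hpK.2 le_rfl hlt.le le_rfl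
  have h2 : D * (p γ K - r γ 1) ≤ η * (1 - r γ 1) := by
    rw [mul_comm, ← le_div_iff₀ (by linarith)]
    linarith
  have h3 : wordBranch γ σ (p γ K) - wordBranch γ σ (r γ 1) ≤
      η * (wordBranch γ σ 1 - wordBranch γ σ (r γ 1)) := by
    refine le_of_mul_le_mul_right ?_ ha
    nlinarith
  linarith

end

end MannevillePomeau

theorem theorem2 (γ : ℝ) (hγ : 0 < γ) :
    SchmidtGame.IsStrongWinning (Icc (MannevillePomeau.r γ 1) 1) (MannevillePomeau.EF γ) ∧
      (∃ C : ℝ, 1 < C ∧ MannevillePomeau.LengthEstimates γ C) ∧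
      ∀ C : ℝ, 1 < C → MannevillePomeau.LengthEstimates γ C →
        SchmidtGame.IsAlphaStrongWinning ((2 : ℝ) ^ (-2 - 1 / γ) * C⁻¹)
          (Icc (MannevillePomeau.r γ 1) 1) (MannevillePomeau.EF γ) := by
  have hwin := MannevillePomeau.isAlphaStrongWinning_EF hγ
  refine ⟨⟨1 / 4, ⟨by norm_num, by norm_num⟩, hwin⟩,
    MannevillePomeau.exists_lengthEstimates hγ, fun C hC _ => hwin.mono ?_⟩
  have h1 : (2 : ℝ) ^ (-2 - 1 / γ) ≤ 2 ^ (-2 : ℝ) :=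
    Real.rpow_le_rpow_of_exponent_le one_le_two (by linarith [one_div_pos.2 hγ])
  have h2 : (2 : ℝ) ^ (-2 : ℝ) = 1 / 4 := by
    rw [Real.rpow_neg two_pos.le]
    norm_num
  calc (2 : ℝ) ^ (-2 - 1 / γ) * C⁻¹ ≤ 2 ^ (-2 - 1 / γ) :=
        mul_le_of_le_one_right (by positivity) (inv_le_one_of_one_le₀ hC.le)
    _ ≤ 1 / 4 := h1.trans_eq h2
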